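/- Consider a quantum spin chain with single-site space $\mathbb{C}^d$ ($d\ge 1$) at every site of $\mathbb{Z}$. For finite $\Lambda\subset\mathbb{Z}$ let $\mathfrak{A}_\Lambda=\mathcal{B}\big(\bigotimes_{x\in\Lambda}\mathbb{C}^d\big)$ with the operator norm, identify $Q\in\mathfrak{A}_{\Lambda'}$ with $Q\otimes\mathbb{1}_{\Lambda\setminus\Lambda'}\in\mathfrak{A}_\Lambda$ for $\Lambda'\subset\Lambda$, and let $\mathfrak{A}_{\mathbb{Z}}$ be the completion of the inductive limit of the algebras $\mathfrak{A}_\Lambda$. An interaction is a family $\Phi=(\Phi_X)_X$ of self-adjoint elements $\Phi_X=\Phi_X^*\in\mathfrak{A}_X$, indexed by the finite sets $X\subset\mathbb{Z}$. It has range $r>0$ and strength $J>0$ if $\Phi_X=0$ whenever $\operatorname{diam}(X)>r$, and $\|\Phi_X\|\le J$ for all $X$. Put $H_\Lambda=\sum_{X\subset\Lambda}\Phi_X$ and $$\psi_\Lambda(Q)=\frac{\operatorname{Tr}(e^{-H_\Lambda}Q)}{\operatorname{Tr}(e^{-H_\Lambda})}\qquad(Q\in\mathfrak{A}_\Lambda),$$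 and let $\tau_t(Q)=\lim_{n\to\infty}e^{itH_{[-n,n]}}\,Q\,e^{-itH_{[-n,n]}}$ ($t\in\mathbb{R}$, $Q\in\mathfrak{A}_{\mathbb{Z}}$) be the time evolution of the infinite chain. A KMS state of $\Phi$ (at inverse temperature $1$) is a state $\psi_{\mathbb{Z}}$ on $\mathfrak{A}_{\mathbb{Z}}$ such that for all $a,b\in\mathfrak{A}_{\mathbb{Z}}$ there is a function $F$, bounded and continuous on $\{0\le\operatorname{Im}z\le 1\}$ and holomorphic on $\{0<\operatorname{Im}z<1\}$, with $F(t)=\psi_{\mathbb{Z}}(a\,\tau_t(b))$ and $F(t+i)=\psi_{\mathbb{Z}}(\tau_t(b)\,a)$ for all $t\in\mathbb{R}$. **Theorem.** For all $r,J,\mathcal{K},\alpha>0$ there are constants $\widetilde{\mathcal{K}},\widetilde{\alpha}>0$, depending only on $r$, $J$, $\mathcal{K}$ and $\alpha$, with the following property. Let $\Phi$ be an interaction on $\mathbb{Z}$ with range $r$ and strength $J$ (for any $d\ge1$), and suppose that its infinite-chain KMS state $\psi_{\mathbb{Z}}$ satisfies exponential decay of correlations with constants $\mathcal{K}$ and $\alpha$: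 for all non-empty finite intervals $A,C\subset\mathbb{Z}$ and all $Q_A\in\mathfrak{A}_A$, $Q_C\in\mathfrak{A}_C$, $$\big|\psi_{\mathbb{Z}}(Q_AQ_C)-\psi_{\mathbb{Z}}(Q_A)\,\psi_{\mathbb{Z}}(Q_C)\big|\le\mathcal{K}\,e^{-\alpha\operatorname{dist}(A,C)}\,\|Q_A\|\,\|Q_C\|.$$ Then for every finite interval $I\subset\mathbb{Z}$ split into three consecutive subintervals $I=ABC$ with $|B|\ge\ell\ge0$, and all $Q_A\in\mathfrak{A}_A$, $Q_C\in\mathfrak{A}_C$, $$\big|\psi_{ABC}(Q_AQ_C)-\psi_{ABC}(Q_A)\,\psi_{ABC}(Q_C)\big|\le\|Q_A\|\,\|Q_C\|\,\widetilde{\mathcal{K}}\,e^{-\widetilde{\alpha}\ell}.$$ -/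

import Mathlib

open Filter Topology
open scoped Matrix.Norms.L2Operator ComplexOrder

noncomputable section

namespace SpinChain

/-! ## Local algebras

The spin chain has the single-site space `ℂ^d` at every site of `ℤ`. For a finite region `Λ` the
Hilbert space `⨂_{x ∈ Λ} ℂ^d` has the standard basis indexed by the configurations `Λ → Fin d`,
and the algebra `𝔄_Λ` of all operators on it is the algebra of matrices indexed by
configurations, with the operator norm of the Euclidean space `ℂ^(Λ → Fin d)`. -/

/-- The algebra `𝔄_Λ` of operators on `⨂_{x ∈ Λ} ℂ^d`. -/
abbrev RegionAlg (d : ℕ) (Λ : Finset ℤ) : Type := Matrix (Λ → Fin d) (Λ → Fin d) ℂ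

/-- Restriction of a configuration to a smaller region. -/
def restr {d : ℕ} {Λ Λ' : Finset ℤ} (h : Λ ⊆ Λ') (σ : Λ' → Fin d) : Λ → Fin d :=
  fun x => σ ⟨x.1, h x.2⟩

/-- Two configurations on `Λ'` coincide at all the sites outside `Λ`. -/
def AgreeOff {d : ℕ} (Λ : Finset ℤ) {Λ' : Finset ℤ} (σ η : Λ' → Fin d) : Prop :=
  ∀ x : Λ', x.1 ∉ Λ → σ x = η x

/-- Overwrite the configuration `σ` on `Λ` by `κ`. -/
def glue {d : ℕ} {Λ Λ' : Finset ℤ} (σ : Λ' → Fin d) (κ : Λ → Fin d) : Λ' → Fin d :=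
  fun x => if hx : x.1 ∈ Λ then κ ⟨x.1, hx⟩ else σ x

open Classical in
/-- The matrix of `M ⊗ 𝟙_{Λ' \ Λ}`. -/
def extendMat {d : ℕ} {Λ Λ' : Finset ℤ} (h : Λ ⊆ Λ') (M : RegionAlg d Λ) : RegionAlg d Λ' :=
  fun σ η => if AgreeOff Λ σ η then M (restr h σ) (restr h η) else 0

section
variable {d : ℕ} {Λ Λ' : Finset ℤ}

lemma restr_glue (h : Λ ⊆ Λ') (σ : Λ' → Fin d) (κ : Λ → Fin d) :
    restr h (glue σ κ) = κ := by
  funext x; simp [restr, glue]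

lemma agreeOff_glue (σ : Λ' → Fin d) (κ : Λ → Fin d) : AgreeOff Λ σ (glue σ κ) := by
  intro x hx; simp [glue, hx]

lemma AgreeOff.symm {σ η : Λ' → Fin d} (h : AgreeOff Λ σ η) : AgreeOff Λ η σ :=
  fun x hx => (h x hx).symm

lemma AgreeOff.trans {σ η κ : Λ' → Fin d} (h : AgreeOff Λ σ η) (h' : AgreeOff Λ η κ) :
    AgreeOff Λ σ κ := fun x hx => (h x hx).trans (h' x hx)

lemma glue_restr (h : Λ ⊆ Λ') {σ η : Λ' → Fin d} (hs : AgreeOff Λ σ η) :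
    glue σ (restr h η) = η := by
  funext x
  by_cases hx : x.1 ∈ Λ
  · simp [glue, hx, restr]
  · simp [glue, hx, hs x hx]

lemma eq_of_agreeOff (h : Λ ⊆ Λ') {σ η : Λ' → Fin d} (hs : AgreeOff Λ σ η)
    (hr : restr h σ = restr h η) : σ = η := by
  rw [← glue_restr h hs, ← hr]
  exact (glue_restr h (fun _ _ => rfl)).symm

lemma extendMat_one (h : Λ ⊆ Λ') : extendMat h (1 : RegionAlg d Λ) = 1 := by
  classical
  ext σ η
  by_cases e : σ = η
  · subst e
    simp [extendMat, AgreeOff]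
  · rw [Matrix.one_apply_ne e, extendMat]
    split_ifs with hs
    · exact Matrix.one_apply_ne fun hr => e (eq_of_agreeOff h hs hr)
    · rfl

lemma extendMat_mul (h : Λ ⊆ Λ') (M N : RegionAlg d Λ) :
    extendMat h (M * N) = extendMat h M * extendMat h N := by
  classical
  ext σ η
  rw [Matrix.mul_apply]
  have key : ∀ κ : Λ' → Fin d, extendMat h M σ κ * extendMat h N κ η =
      if AgreeOff Λ σ κ then
        (if AgreeOff Λ σ η then M (restr h σ) (restr h κ) * N (restr h κ) (restr h η) else 0)
      else 0 := by
    intro κ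
    by_cases h1 : AgreeOff Λ σ κ
    · have : AgreeOff Λ κ η ↔ AgreeOff Λ σ η := ⟨h1.trans, h1.symm.trans⟩
      by_cases h2 : AgreeOff Λ σ η <;> simp [extendMat, h1, h2, this]
    · simp [extendMat, h1]
  simp_rw [key]
  rw [← Finset.sum_filter]
  by_cases h2 : AgreeOff Λ σ η
  · simp only [extendMat, h2, if_true, Matrix.mul_apply]
    refine Finset.sum_nbij' (fun κ => glue σ κ) (fun κ => restr h κ) ?_ ?_ ?_ ?_ ?_
    · intro κ _; simp [agreeOff_glue]
    · intro κ _; simp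
    · intro κ _; exact restr_glue h σ κ
    · intro κ hκ; exact glue_restr h (Finset.mem_filter.1 hκ).2
    · intro κ _; simp [restr_glue]
  · simp [extendMat, h2]

end

/-- The canonical embedding `𝔄_Λ → 𝔄_Λ'`, `Q ↦ Q ⊗ 𝟙`, for `Λ ⊆ Λ'`. -/
def extend (d : ℕ) {Λ Λ' : Finset ℤ} (h : Λ ⊆ Λ') : RegionAlg d Λ →⋆ₐ[ℂ] RegionAlg d Λ' where
  toFun := extendMat h
  map_one' := extendMat_one h
  map_mul' := extendMat_mul h
  map_zero' := by ext σ η; simp [extendMat]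
  map_add' M N := by
    ext σ η
    by_cases hs : AgreeOff Λ σ η <;> simp [extendMat, hs]
  commutes' c := by
    rw [Algebra.algebraMap_eq_smul_one, Algebra.algebraMap_eq_smul_one,
      ← extendMat_one (d := d) h]
    ext σ η
    by_cases hs : AgreeOff Λ σ η <;> simp [extendMat, hs]
  map_star' M := by
    ext σ η
    have : AgreeOff Λ η σ ↔ AgreeOff Λ σ η := ⟨AgreeOff.symm, AgreeOff.symm⟩
    by_cases hs : AgreeOff Λ σ η <;>
      simp [extendMat, hs, this]

lemma extend_apply {d : ℕ} {Λ Λ' : Finset ℤ} (h : Λ ⊆ Λ') (M : RegionAlg d Λ) :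
    extend d h M = extendMat h M := rfl

lemma extend_injective (d : ℕ) [NeZero d] {Λ Λ' : Finset ℤ} (h : Λ ⊆ Λ') :
    Function.Injective (extend d h) := by
  intro M N hMN
  ext κ κ'
  have := congrFun (congrFun hMN (glue (fun _ => 0) κ)) (glue (fun _ => 0) κ')
  have hs : AgreeOff Λ (glue (fun _ : Λ' => (0 : Fin d)) κ) (glue (fun _ => 0) κ') :=
    (agreeOff_glue _ κ).symm.trans (agreeOff_glue _ κ')
  simpa [extend_apply, extendMat, hs, restr_glue] using this

lemma norm_extend (d : ℕ) [NeZero d] {Λ Λ' : Finset ℤ} (h : Λ ⊆ Λ') (M : RegionAlg d Λ) :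
    ‖extend d h M‖ = ‖M‖ :=
  NonUnitalStarAlgHom.norm_map (extend d h) (extend_injective d h) M

instance (d : ℕ) : DirectedSystem (RegionAlg d) (fun _ _ h => ⇑(extend d h)) where
  map_self Λ M := by
    ext σ η
    have hs : AgreeOff Λ σ η := fun x hx => absurd x.2 hx
    simp only [extend_apply, extendMat, hs, if_true]
    rfl
  map_map Λ₃ Λ₂ Λ₁ h₁ h₂ M := by
    ext σ η
    have : AgreeOff Λ₁ σ η ↔
        AgreeOff Λ₂ σ η ∧ AgreeOff Λ₁ (restr h₂ σ) (restr h₂ η) := by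
      constructor
      · intro H
        exact ⟨fun x hx => H x fun hx' => hx (h₁ hx'), fun x hx => H ⟨x.1, h₂ x.2⟩ hx⟩
      · rintro ⟨H₁, H₂⟩ x hx
        by_cases hx' : x.1 ∈ Λ₂
        · exact H₂ ⟨x.1, hx'⟩ hx
        · exact H₁ x hx'
    by_cases a : AgreeOff Λ₂ σ η <;>
      by_cases b : AgreeOff Λ₁ (restr h₂ σ) (restr h₂ η) <;>
        simp [extend_apply, extendMat, this, a, b] <;> rfl

/-! ## The algebra of local observables and the quasi-local algebra -/

/-- The algebra `𝔄_loc` of local observables: the inductive limit of the algebras `𝔄_Λ`. -/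
def LocalAlg (d : ℕ) : Type :=
  DirectLimit (RegionAlg d) (fun _ _ (h : _ ≤ _) => extend d h)

namespace LocalAlg
variable (d : ℕ)

instance : Ring (LocalAlg d) :=
  inferInstanceAs (Ring (DirectLimit (RegionAlg d) (fun _ _ (h : _ ≤ _) => extend d h)))

instance : Algebra ℂ (LocalAlg d) :=
  inferInstanceAs (Algebra ℂ (DirectLimit (RegionAlg d) (fun _ _ (h : _ ≤ _) => extend d h)))

instance : StarRing (LocalAlg d) :=
  inferInstanceAs (StarRing (DirectLimit (RegionAlg d) (fun _ _ (h : _ ≤ _) => extend d h)))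

instance : StarModule ℂ (LocalAlg d) :=
  inferInstanceAs (StarModule ℂ (DirectLimit (RegionAlg d) (fun _ _ (h : _ ≤ _) => extend d h)))

/-- The canonical map `𝔄_Λ → 𝔄_loc`. -/
def of (Λ : Finset ℤ) : RegionAlg d Λ →⋆ₐ[ℂ] LocalAlg d where
  toFun M := (⟦⟨Λ, M⟩⟧ : DirectLimit (RegionAlg d) (fun _ _ (h : _ ≤ _) => extend d h))
  map_one' := (DirectLimit.one_def Λ).symm
  map_mul' M N := (DirectLimit.mul_def Λ M N).symm
  map_zero' := (DirectLimit.zero_def Λ).symm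
  map_add' M N := (DirectLimit.add_def Λ M N).symm
  commutes' c := (DirectLimit.algebraMap_def Λ c).symm
  map_star' M := (DirectLimit.star_def Λ M).symm

variable {d}

lemma of_extend {Λ Λ' : Finset ℤ} (h : Λ ⊆ Λ') (M : RegionAlg d Λ) :
    of d Λ' (extend d h M) = of d Λ M :=
  DirectLimit.mk_apply (f := fun _ _ (h : _ ≤ _) => extend d h) Λ Λ' M h

lemma exists_of (a : LocalAlg d) : ∃ Λ M, a = of d Λ M := by
  obtain ⟨Λ, M, h⟩ := DirectLimit.exists_eq_mk _ a
  exact ⟨Λ, M, h⟩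

lemma exists_of₂ (a b : LocalAlg d) : ∃ Λ M N, a = of d Λ M ∧ b = of d Λ N := by
  obtain ⟨Λ, M, N, h, h'⟩ := DirectLimit.exists_eq_mk₂ _ a b
  exact ⟨Λ, M, N, h, h'⟩

variable [NeZero d]

/-- The norm of a local observable is its operator norm on any region where it lives. -/
instance : Norm (LocalAlg d) where
  norm := DirectLimit.lift (fun _ _ (h : _ ≤ _) => extend d h) (fun _ M => ‖M‖)
    (fun _ _ h M => (norm_extend d h M).symm)

lemma norm_of (Λ : Finset ℤ) (M : RegionAlg d Λ) : ‖of d Λ M‖ = ‖M‖ := rfl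

instance : NormedAddCommGroup (LocalAlg d) :=
  AddGroupNorm.toNormedAddCommGroup
    { toFun := fun a => ‖a‖
      map_zero' := by
        change ‖(0 : LocalAlg d)‖ = 0
        rw [← map_zero (of d ∅), norm_of, norm_zero]
      add_le' := fun a b => by
        obtain ⟨Λ, M, N, rfl, rfl⟩ := exists_of₂ a b
        rw [← map_add]
        exact norm_add_le M N
      neg' := fun a => by
        obtain ⟨Λ, M, rfl⟩ := exists_of a
        rw [← map_neg]
        exact norm_neg M
      eq_zero_of_map_eq_zero' := fun a h => by
        obtain ⟨Λ, M, rfl⟩ := exists_of a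
        rw [norm_of, norm_eq_zero] at h
        rw [h, map_zero] }

instance : NormedRing (LocalAlg d) where
  __ := (inferInstance : NormedAddCommGroup (LocalAlg d))
  __ := (inferInstance : Ring (LocalAlg d))
  norm_mul_le a b := by
    obtain ⟨Λ, M, N, rfl, rfl⟩ := exists_of₂ a b
    rw [← map_mul]
    exact norm_mul_le M N

instance : NormedAlgebra ℂ (LocalAlg d) where
  norm_smul_le c a := by
    obtain ⟨Λ, M, rfl⟩ := exists_of a
    rw [← map_smul]
    exact norm_smul_le c M

instance : CStarRing (LocalAlg d) where
  norm_mul_self_le a := by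
    obtain ⟨Λ, M, rfl⟩ := exists_of a
    rw [← map_star, ← map_mul]
    exact CStarRing.norm_mul_self_le M

end LocalAlg

open UniformSpace in
/-- The algebra `𝔄_ℤ` of quasi-local observables: the completion of `𝔄_loc` in the operator
norm. -/
def QuasiLocalAlg (d : ℕ) [NeZero d] : Type := Completion (LocalAlg d)

namespace QuasiLocalAlg
open UniformSpace
variable (d : ℕ) [NeZero d]

instance : NormedRing (QuasiLocalAlg d) := inferInstanceAs (NormedRing (Completion (LocalAlg d)))

instance : CompleteSpace (QuasiLocalAlg d) :=
  inferInstanceAs (CompleteSpace (Completion (LocalAlg d)))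

instance : Algebra ℂ (QuasiLocalAlg d) := inferInstanceAs (Algebra ℂ (Completion (LocalAlg d)))

instance : NormedAlgebra ℂ (QuasiLocalAlg d) where
  norm_smul_le c a := norm_smul_le (α := ℂ) (β := Completion (LocalAlg d)) c a

/-- The canonical map `𝔄_loc → 𝔄_ℤ`. -/
def ofLocal (a : LocalAlg d) : QuasiLocalAlg d := (a : Completion (LocalAlg d))

/-- The adjoint, extended from `𝔄_loc` by continuity. -/
instance : Star (QuasiLocalAlg d) where
  star := Completion.map (star : LocalAlg d → LocalAlg d)

variable {d}

lemma ofLocal_one : ofLocal d 1 = 1 := Completion.coe_one _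

lemma ofLocal_zero : ofLocal d 0 = 0 := Completion.coe_zero

lemma ofLocal_mul (a b : LocalAlg d) : ofLocal d (a * b) = ofLocal d a * ofLocal d b :=
  Completion.coe_mul a b

lemma ofLocal_add (a b : LocalAlg d) : ofLocal d (a + b) = ofLocal d a + ofLocal d b :=
  Completion.coe_add a b

lemma ofLocal_smul (c : ℂ) (a : LocalAlg d) : ofLocal d (c • a) = c • ofLocal d a :=
  Completion.coe_smul c a

lemma norm_ofLocal (a : LocalAlg d) : ‖ofLocal d a‖ = ‖a‖ := Completion.norm_coe a

lemma ofLocal_star (a : LocalAlg d) : ofLocal d (star a) = star (ofLocal d a) :=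
  (Completion.map_coe star_isometry.uniformContinuous a).symm

lemma continuous_star_aux : Continuous fun a : QuasiLocalAlg d => star a :=
  Completion.continuous_map

lemma ofLocal_induction {p : QuasiLocalAlg d → Prop} (a : QuasiLocalAlg d)
    (hc : IsClosed {a | p a}) (h : ∀ a, p (ofLocal d a)) : p a :=
  Completion.induction_on a hc h

lemma ofLocal_induction₂ {p : QuasiLocalAlg d → QuasiLocalAlg d → Prop} (a b : QuasiLocalAlg d)
    (hc : IsClosed {x : QuasiLocalAlg d × QuasiLocalAlg d | p x.1 x.2})
    (h : ∀ a b, p (ofLocal d a) (ofLocal d b)) : p a b :=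
  Completion.induction_on₂ a b hc h

variable (d)

instance : StarRing (QuasiLocalAlg d) where
  star_involutive a := by
    refine ofLocal_induction (p := fun a => star (star a) = a) a (isClosed_eq
      (continuous_star_aux.comp continuous_star_aux) continuous_id) fun a => ?_
    rw [← ofLocal_star, ← ofLocal_star, star_star]
  star_mul a b := by
    refine ofLocal_induction₂ (p := fun a b => star (a * b) = star b * star a) a b (isClosed_eq
      (continuous_star_aux.comp (continuous_fst.mul continuous_snd))
      ((continuous_star_aux.comp continuous_snd).mul
        (continuous_star_aux.comp continuous_fst))) fun a b => ?_
    simp only [← ofLocal_star, ← ofLocal_mul, star_mul]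
  star_add a b := by
    refine ofLocal_induction₂ (p := fun a b => star (a + b) = star a + star b) a b (isClosed_eq
      (continuous_star_aux.comp (continuous_fst.add continuous_snd))
      ((continuous_star_aux.comp continuous_fst).add
        (continuous_star_aux.comp continuous_snd))) fun a b => ?_
    simp only [← ofLocal_star, ← ofLocal_add, star_add]

instance : CStarRing (QuasiLocalAlg d) where
  norm_mul_self_le a := by
    refine ofLocal_induction (p := fun a => ‖a‖ * ‖a‖ ≤ ‖star a * a‖) a
      (isClosed_le (continuous_norm.mul continuous_norm)
        (continuous_norm.comp (continuous_star_aux.mul continuous_id))) fun a => ?_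
    simp only [← ofLocal_star, ← ofLocal_mul, norm_ofLocal]
    exact CStarRing.norm_mul_self_le a

instance : StarModule ℂ (QuasiLocalAlg d) where
  star_smul c a := by
    refine ofLocal_induction (p := fun a => star (c • a) = star c • star a) a (isClosed_eq
      (continuous_star_aux.comp (continuous_const_smul c))
      (continuous_star_aux.const_smul (star c))) fun a => ?_
    simp only [← ofLocal_star, ← ofLocal_smul, star_smul]

instance : CStarAlgebra (QuasiLocalAlg d) where

end QuasiLocalAlg

open QuasiLocalAlg in
/-- The canonical (isometric, unital) embedding `𝔄_Λ → 𝔄_ℤ`. -/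
def embed (d : ℕ) [NeZero d] (Λ : Finset ℤ) : RegionAlg d Λ →⋆ₐ[ℂ] QuasiLocalAlg d where
  toFun M := ofLocal d (LocalAlg.of d Λ M)
  map_one' := by rw [map_one, ofLocal_one]
  map_mul' M N := by rw [map_mul, ofLocal_mul]
  map_zero' := by rw [map_zero, ofLocal_zero]
  map_add' M N := by rw [map_add, ofLocal_add]
  commutes' c := by
    rw [Algebra.algebraMap_eq_smul_one, Algebra.algebraMap_eq_smul_one, map_smul, map_one,
      ofLocal_smul, ofLocal_one]
  map_star' M := by rw [map_star, ofLocal_star]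

/-! ## Interactions, dynamics and thermal states -/

/-- An interaction `Φ = (Φ_X)_X`: a self-adjoint `Φ_X ∈ 𝔄_X` for every finite `X ⊆ ℤ`. -/
structure Interaction (d : ℕ) where
  /-- The interaction term of the finite set `X`. -/
  term : ∀ X : Finset ℤ, RegionAlg d X
  isSelfAdjoint : ∀ X, IsSelfAdjoint (term X)

namespace Interaction
variable {d : ℕ} (Φ : Interaction d)

/-- `Φ` has range (at most) `r`: the terms of the sets of diameter greater than `r` vanish. -/
def HasRange (r : ℝ) : Prop :=
  ∀ X : Finset ℤ, r < Metric.diam (X : Set ℤ) → Φ.term X = 0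

/-- `Φ` has strength (at most) `J`. -/
def HasStrength (J : ℝ) : Prop := ∀ X : Finset ℤ, ‖Φ.term X‖ ≤ J

/-- The Hamiltonian `H_Λ = ∑_{X ⊆ Λ} Φ_X`. -/
def hamiltonian (Λ : Finset ℤ) : RegionAlg d Λ :=
  ∑ X ∈ Λ.powerset.attach, extend d (Finset.mem_powerset.1 X.2) (Φ.term X.1)

/-- The Gibbs state of the region `Λ` at inverse temperature `1`:
`ψ_Λ(Q) = Tr(e^{-H_Λ} Q) / Tr(e^{-H_Λ})`. -/
def gibbs (Λ : Finset ℤ) (Q : RegionAlg d Λ) : ℂ :=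
  (NormedSpace.exp (-Φ.hamiltonian Λ) * Q).trace / (NormedSpace.exp (-Φ.hamiltonian Λ)).trace

variable [NeZero d]

/-- The time evolution generated by the Hamiltonian of the finite region `Λ`:
`Q ↦ e^{itH_Λ} Q e^{-itH_Λ}`. -/
def regionEvolution (Λ : Finset ℤ) (t : ℝ) (Q : QuasiLocalAlg d) : QuasiLocalAlg d :=
  embed d Λ (NormedSpace.exp ((Complex.I * t) • Φ.hamiltonian Λ)) * Q *
    embed d Λ (NormedSpace.exp (-(Complex.I * t) • Φ.hamiltonian Λ))

/-- The time evolution of the infinite chain: the norm limit, as `n → ∞`, of the evolutions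
generated by the Hamiltonians of the intervals `[-n, n]`. For an interaction with finite range
and strength this limit exists for all `t` and `Q`. -/
def evolution (t : ℝ) (Q : QuasiLocalAlg d) : QuasiLocalAlg d :=
  limUnder atTop fun n : ℕ => Φ.regionEvolution (Finset.Icc (-(n : ℤ)) n) t Q

end Interaction

variable {d : ℕ} [NeZero d]

/-- A state on `𝔄_ℤ`: a positive normalized (continuous) linear functional. -/
structure IsState (ψ : QuasiLocalAlg d →L[ℂ] ℂ) : Prop where
  map_one : ψ 1 = 1
  nonneg : ∀ a : QuasiLocalAlg d, 0 ≤ ψ (star a * a)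

/-- `ψ` is a KMS state for `Φ` at inverse temperature `1`: a state such that for all
`a, b ∈ 𝔄_ℤ` there is a function `F` that is continuous and bounded on the closed strip
`0 ≤ Im z ≤ 1`, holomorphic on the open strip, and has the boundary values
`F(t) = ψ(a τ_t(b))` and `F(t + i) = ψ(τ_t(b) a)`, where `τ` is the time evolution of the
infinite chain. -/
structure IsKMSState (Φ : Interaction d) (ψ : QuasiLocalAlg d →L[ℂ] ℂ) : Prop where
  isState : IsState ψ
  kms : ∀ a b : QuasiLocalAlg d, ∃ F : ℂ → ℂ,
    ContinuousOn F {z | 0 ≤ z.im ∧ z.im ≤ 1} ∧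
    DifferentiableOn ℂ F {z | 0 < z.im ∧ z.im < 1} ∧
    (∃ C : ℝ, ∀ z : ℂ, 0 ≤ z.im → z.im ≤ 1 → ‖F z‖ ≤ C) ∧
    (∀ t : ℝ, F t = ψ (a * Φ.evolution t b)) ∧
    (∀ t : ℝ, F (t + Complex.I) = ψ (Φ.evolution t b * a))

/-- The distance `min {|x - y| : x ∈ S, y ∈ T}` of two nonempty finite sets of sites. -/
def siteDist (S T : Finset ℤ) : ℝ := ⨅ p : S × T, dist (p.1 : ℤ) (p.2 : ℤ)

/-- Exponential decay of correlations with constants `K` and `α`, for all observables supported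
in (nonempty) finite intervals. -/
def ExpDecay (ψ : QuasiLocalAlg d →L[ℂ] ℂ) (K α : ℝ) : Prop :=
  ∀ a b c e : ℤ, a ≤ b → c ≤ e →
    ∀ (QA : RegionAlg d (Finset.Icc a b)) (QC : RegionAlg d (Finset.Icc c e)),
      ‖ψ (embed d _ QA * embed d _ QC) - ψ (embed d _ QA) * ψ (embed d _ QC)‖ ≤
        K * Real.exp (-α * siteDist (Finset.Icc a b) (Finset.Icc c e)) * ‖QA‖ * ‖QC‖

end SpinChain

end

noncomputable section

/-! ## Conjugation by exponentials in Banach algebras -/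

/-! The Gibbs state of `I = [a, e)` is recovered from the KMS state `ψ` by removing the interaction
across the two ends of `I`. For a large box `Λ` let `H` be its Hamiltonian and `D` the Hamiltonian
without the terms coupling `I` to the rest. The expansionals `exp H * exp (-D)` converge to some `E`
as `Λ` exhausts `ℤ`. Evaluated at imaginary time, the KMS condition of `ψ` becomes a KMS condition
with Hamiltonian `H_I` for `Q ↦ ψ (E * Q)` on `𝔄_I`. On a matrix algebra this leaves only multiples
of the Gibbs state, so `ψ (E * Q) = ψ E * ψ_I(Q)` (`apply_mul_embed_eq`).

Up to an exponentially small error, `E` is a product `S * T` with `S` localized near `a` and `T`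
near `e`. Since `T` commutes with `Q_A`, decay of correlations gives `ψ (E Q_A Q_C) ≈ ψ (S Q_A) ψ (T
Q_C)`, and likewise with `Q_A` or `Q_C` replaced by `1` (`norm_apply_mul_sub_le`). Hence `ψ (E Q_A
Q_C) ψ(E) ≈ ψ (E Q_A) ψ (E Q_C)`, and division by `ψ(E)²` is the claim. The division needs a lower
bound on `|ψ(E)|` uniform in `I` and `d` (`norm_apply_limit_ge`): evolving by half a unit of
imaginary time does not change `ψ(E)` and turns the expansional into a positive element with bounded
inverse.

The analytic input is Araki's bound `norm_adL_pow_le`. In one dimension only the boundedly many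
terms near the two ends of an interval can enlarge the support of an observable, so the commutator
series converges at every complex time, uniformly in the volume. It yields existence, bounds and
locality of the complex evolution and of the expansionals. -/

theorem HasSum.congr_fun' {ι M : Type*} [AddCommMonoid M] [TopologicalSpace M] {f g : ι → M} {a : M}
    (h : HasSum f a) (hfg : ∀ i, g i = f i) : HasSum g a :=
  (funext hfg : g = f) ▸ h

namespace BanachConj
open NormedSpace

variable {A : Type*} [NormedRing A] [NormedAlgebra ℂ A]

/-- The bounded operator `Q ↦ H Q - Q H`. -/
def adL (H : A) : A →L[ℂ] A :=
  ContinuousLinearMap.mul ℂ A H - (ContinuousLinearMap.mul ℂ A).flip H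

lemma adL_apply (H Q : A) : adL H Q = H * Q - Q * H := rfl

/-- `e^{zH} Q e^{-zH}`. -/
def conjExp (z : ℂ) (H Q : A) : A := exp (z • H) * Q * exp (-(z • H))

lemma conjExp_add (z : ℂ) (H P Q : A) :
    conjExp z H (P + Q) = conjExp z H P + conjExp z H Q := by
  simp [conjExp, mul_add, add_mul]

variable [CompleteSpace A]

lemma exp_add_of_commute' {x y : A} (h : Commute x y) : exp (x + y) = exp x * exp y :=
  let _ : NormedAlgebra ℚ A := NormedAlgebra.restrictScalars ℚ ℂ A
  exp_add_of_commute h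

lemma exp_mul_exp_neg (x : A) : exp x * exp (-x) = 1 := by
  rw [← exp_add_of_commute' (Commute.neg_right (Commute.refl x)), add_neg_cancel, exp_zero]

lemma exp_neg_mul_exp (x : A) : exp (-x) * exp x = 1 := by
  simpa using exp_mul_exp_neg (-x)

lemma exp_add_smul (z w : ℂ) (x : A) : exp ((z + w) • x) = exp (z • x) * exp (w • x) := by
  rw [add_smul, exp_add_of_commute']
  exact ((Commute.refl x).smul_left z).smul_right w

lemma conjExp_conjExp (z w : ℂ) (H Q : A) :
    conjExp z H (conjExp w H Q) = conjExp (z + w) H Q := by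
  have : exp (-((z + w) • H)) = exp (-(w • H)) * exp (-(z • H)) := by
    rw [← neg_smul, ← neg_smul, ← neg_smul, ← exp_add_smul]
    congr 2; ring
  simp only [conjExp]
  rw [exp_add_smul, this]
  simp only [mul_assoc]

lemma exp_mulLeft_apply (x y : A) : exp (ContinuousLinearMap.mul ℂ A x) y = exp x * y := by
  have h1 := (exp_series_hasSum_exp' (𝕂 := ℂ) (ContinuousLinearMap.mul ℂ A x)).mapL
    (ContinuousLinearMap.apply ℂ A y)
  have h2 := (exp_series_hasSum_exp' (𝕂 := ℂ) x).mul_right y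
  refine h1.unique ?_
  have : ∀ n : ℕ, ((ContinuousLinearMap.mul ℂ A x) ^ n) y = x ^ n * y := by
    intro n
    induction n with
    | zero => simp
    | succ n ih =>
      rw [pow_succ', mul_apply_eq_comp, ih, pow_succ', mul_assoc]; rfl
  exact h2.congr_fun' fun n => by simp [this]

lemma exp_mulRight_apply (x y : A) :
    exp ((ContinuousLinearMap.mul ℂ A).flip x) y = y * exp x := by
  have h1 := (exp_series_hasSum_exp' (𝕂 := ℂ) ((ContinuousLinearMap.mul ℂ A).flip x)).mapL
    (ContinuousLinearMap.apply ℂ A y)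
  have h2 := (exp_series_hasSum_exp' (𝕂 := ℂ) x).mul_left y
  refine h1.unique ?_
  have : ∀ n : ℕ, (((ContinuousLinearMap.mul ℂ A).flip x) ^ n) y = y * x ^ n := by
    intro n
    induction n with
    | zero => simp
    | succ n ih =>
      rw [pow_succ', mul_apply_eq_comp, ih, pow_succ, ← mul_assoc]; rfl
  exact h2.congr_fun' fun n => by simp [this]

/-- Left and right multiplication commute, so conjugation is the exponential of the commutator map.
The estimates on complex time evolution are read off this series. -/
lemma hasSum_conjExp (z : ℂ) (H Q : A) :
    HasSum (fun j : ℕ => (z ^ j / j.factorial) • (adL H ^ j) Q) (conjExp z H Q) := by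
  have hc : Commute (ContinuousLinearMap.mul ℂ A (z • H))
      ((ContinuousLinearMap.mul ℂ A).flip (-(z • H))) := by
    ext y
    simp [mul_assoc]
  have he : exp (z • adL H) Q = conjExp z H Q := by
    have : z • adL H = ContinuousLinearMap.mul ℂ A (z • H) +
        (ContinuousLinearMap.mul ℂ A).flip (-(z • H)) := by
      ext y
      simp [adL_apply, sub_eq_add_neg]
    rw [this, exp_add_of_commute' hc, mul_apply_eq_comp, exp_mulRight_apply,
      exp_mulLeft_apply, conjExp, mul_assoc]
  have h1 := (exp_series_hasSum_exp' (𝕂 := ℂ) (z • adL H)).mapL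
    (ContinuousLinearMap.apply ℂ A Q)
  rw [ContinuousLinearMap.apply_apply, he] at h1
  have hp : ∀ n : ℕ, ((z • adL H) ^ n) Q = z ^ n • (adL H ^ n) Q := by
    intro n
    induction n with
    | zero => simp
    | succ n ih =>
      rw [pow_succ', mul_apply_eq_comp, ih, pow_succ' (adL H), mul_apply_eq_comp,
        smul_apply, map_smul, smul_smul, pow_succ']
  exact h1.congr_fun' fun n => by
    rw [ContinuousLinearMap.apply_apply, smul_apply, hp, smul_smul,
      div_eq_inv_mul]

/-! ### Interaction picture -/

/-- In this linear equation only the evolved difference `H - H₀` drives the growth, so the norms of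
`H` and `H₀`, which diverge with the volume, never enter the bounds. -/
lemma hasDerivAt_expansional (H H₀ : A) (s : ℝ) :
    HasDerivAt (fun t : ℝ => exp ((t : ℂ) • H) * exp (-((t : ℂ) • H₀)))
      (conjExp s H (H - H₀) * (exp ((s : ℂ) • H) * exp (-((s : ℂ) • H₀)))) s := by
  have h1 := (hasDerivAt_exp_smul_const (𝕂 := ℂ) H (s : ℂ)).scomp s
    (hasDerivAt_id s).ofReal_comp
  have h2 := (hasDerivAt_exp_smul_const' (𝕂 := ℂ) (-H₀) (s : ℂ)).scomp s
    (hasDerivAt_id s).ofReal_comp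
  simp only [smul_neg, Complex.ofReal_one, one_smul] at h1 h2
  refine (h1.mul h2).congr_deriv ?_
  have e : exp (-((s : ℂ) • H)) * exp ((s : ℂ) • H) = 1 := exp_neg_mul_exp _
  simp only [Function.comp_apply, conjExp]
  generalize exp (-((s : ℂ) • H)) = x at *
  generalize exp (-((s : ℂ) • H₀)) = y at *
  generalize exp ((s : ℂ) • H) = u at *
  calc _ = u * (H - H₀) * 1 * y := by noncomm_ring
    _ = _ := by rw [← e]; simp only [mul_assoc]

variable [NormOneClass A]

/-- A bound on `e^{H} e^{-H₀}` in terms of the perturbation `H - H₀` evolved with `H`. -/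
lemma norm_expansional_le {H H₀ : A} {M : ℝ}
    (h : ∀ s : ℝ, 0 ≤ s → s ≤ 1 → ‖conjExp s H (H - H₀)‖ ≤ M) {s : ℝ} (hs : 0 ≤ s) (hs' : s ≤ 1) :
    ‖exp ((s : ℂ) • H) * exp (-((s : ℂ) • H₀))‖ ≤ Real.exp M := by
  have hM : 0 ≤ M := (norm_nonneg _).trans (h 0 le_rfl zero_le_one)
  have := norm_le_gronwallBound_of_norm_deriv_right_le (δ := 1) (K := M) (ε := 0) (a := 0) (b := 1)
    (f := fun t : ℝ => exp ((t : ℂ) • H) * exp (-((t : ℂ) • H₀)))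
    (fun t _ => (hasDerivAt_expansional H H₀ t).continuousAt.continuousWithinAt)
    (fun t _ => (hasDerivAt_expansional H H₀ t).hasDerivWithinAt)
    (by simp) (fun t ht => by
      rw [add_zero]
      exact (norm_mul_le _ _).trans
        (mul_le_mul_of_nonneg_right (h t ht.1 ht.2.le) (norm_nonneg _))) s ⟨hs, hs'⟩
  refine this.trans ?_
  rw [gronwallBound_ε0, one_mul, Real.exp_le_exp]
  nlinarith

/-- Stability of `e^{H} e^{-H₀}` under changes of the evolved perturbation. -/
lemma norm_expansional_sub_le {H H₀ H' H₀' : A} {M ε : ℝ} (hM : 0 < M) (hε : 0 ≤ ε)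
    (h : ∀ s : ℝ, 0 ≤ s → s ≤ 1 → ‖conjExp s H (H - H₀)‖ ≤ M)
    (h' : ∀ s : ℝ, 0 ≤ s → s ≤ 1 → ‖conjExp s H' (H' - H₀')‖ ≤ M)
    (hd : ∀ s : ℝ, 0 ≤ s → s ≤ 1 →
      ‖conjExp s H (H - H₀) - conjExp s H' (H' - H₀')‖ ≤ ε) :
    ‖exp H * exp (-H₀) - exp H' * exp (-H₀')‖ ≤ ε * (Real.exp M * Real.exp M / M) := by
  have key := norm_le_gronwallBound_of_norm_deriv_right_le (δ := 0) (K := M)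
    (ε := ε * Real.exp M) (a := 0) (b := 1)
    (f := fun t : ℝ => exp ((t : ℂ) • H) * exp (-((t : ℂ) • H₀)) -
      exp ((t : ℂ) • H') * exp (-((t : ℂ) • H₀')))
    (fun t _ => ((hasDerivAt_expansional H H₀ t).sub
      (hasDerivAt_expansional H' H₀' t)).continuousAt.continuousWithinAt)
    (fun t _ => ((hasDerivAt_expansional H H₀ t).sub
      (hasDerivAt_expansional H' H₀' t)).hasDerivWithinAt)
    (by simp) (fun t ht => by
      set X := conjExp t H (H - H₀)
      set Y := conjExp t H' (H' - H₀')
      set f := exp ((t : ℂ) • H) * exp (-((t : ℂ) • H₀))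
      set g := exp ((t : ℂ) • H') * exp (-((t : ℂ) • H₀'))
      -- Grönwall for `f - g`: rate `M`, inhomogeneity `ε * exp M`, initial value `0`.
      have e : X * f - Y * g = X * (f - g) + (X - Y) * g := by noncomm_ring
      rw [e]
      refine (norm_add_le _ _).trans (add_le_add ((norm_mul_le _ _).trans ?_)
        ((norm_mul_le _ _).trans ?_))
      · exact mul_le_mul_of_nonneg_right (h t ht.1 ht.2.le) (norm_nonneg _)
      · exact mul_le_mul (hd t ht.1 ht.2.le) (norm_expansional_le h' ht.1 ht.2.le)
          (norm_nonneg _) hε) 1 ⟨zero_le_one, le_rfl⟩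
  simp only [Complex.ofReal_one, one_smul, sub_zero] at key
  refine key.trans ?_
  simp only [gronwallBound_of_K_ne_0 hM.ne', zero_mul, zero_add, mul_one]
  have : Real.exp M - 1 ≤ Real.exp M := by linarith
  calc ε * Real.exp M / M * (Real.exp M - 1) ≤ ε * Real.exp M / M * Real.exp M := by gcongr
    _ = _ := by ring

end BanachConj

end

noncomputable section

/-! ## The majorant series -/

/-- The weights of words of `j` commutators started on an interval that has already been enlarged
`p` times: a commutator either stays inside the interval or enlarges it. -/
def growthCoeff (a μ : ℝ) : ℕ → ℕ → ℝ
  | 0, _ => 1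
  | j + 1, p => (a + μ * p) * growthCoeff a μ j p + μ * growthCoeff a μ j (p + 1)

lemma growthCoeff_nonneg {a μ : ℝ} (ha : 0 ≤ a) (hμ : 0 ≤ μ) (j p : ℕ) :
    0 ≤ growthCoeff a μ j p := by
  induction j generalizing p with
  | zero => simp [growthCoeff]
  | succ j ih =>
    have := ih p
    have := ih (p + 1)
    simp only [growthCoeff]
    positivity

/-- The bounds `f_p(s)` solve `f_p' = (a + μ p) f_p + μ f_{p+1}`, because `f_{p+1} = f_p * exp (μ
s)`. Differentiating a partial sum produces the same recursion with one term fewer, whence the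
induction on `N` for all `p` and `s` at once. -/
lemma sum_growthCoeff_le {a μ : ℝ} (ha : 0 ≤ a) (hμ : 0 ≤ μ) (N p : ℕ) {s : ℝ} (hs : 0 ≤ s) :
    ∑ j ∈ Finset.range N, growthCoeff a μ j p * (s ^ j / j.factorial) ≤
      Real.exp ((a + μ * p) * s + (Real.exp (μ * s) - 1)) := by
  induction N generalizing p s with
  | zero => simpa using (Real.exp_pos _).le
  | succ N ih =>
    let f : ℝ → ℝ := fun s => Real.exp ((a + μ * p) * s + (Real.exp (μ * s) - 1)) -
      ∑ j ∈ Finset.range (N + 1), growthCoeff a μ j p * (s ^ j / j.factorial)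
    have hf : ∀ s, HasDerivAt f (Real.exp ((a + μ * p) * s + (Real.exp (μ * s) - 1)) *
        ((a + μ * p) + Real.exp (μ * s) * μ) -
        ∑ j ∈ Finset.range N, growthCoeff a μ (j + 1) p * (s ^ j / j.factorial)) s := by
      intro s
      refine HasDerivAt.sub ?_ ?_
      · refine HasDerivAt.exp (HasDerivAt.add ?_ (HasDerivAt.sub_const _ (HasDerivAt.exp ?_)))
        · simpa using (hasDerivAt_id s).const_mul (a + μ * p)
        · simpa using (hasDerivAt_id s).const_mul μ
      · have := HasDerivAt.fun_sum (u := Finset.range (N + 1)) (x := s)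
          (A := fun j s => growthCoeff a μ j p * (s ^ j / j.factorial)) (fun j _ =>
            ((hasDerivAt_pow j s).div_const (j.factorial : ℝ)).const_mul (growthCoeff a μ j p))
        refine this.congr_deriv ?_
        rw [Finset.sum_range_succ']
        simp only [Nat.cast_zero, zero_mul, zero_div, mul_zero, add_zero]
        refine Finset.sum_congr rfl fun j _ => ?_
        congr 1
        rw [Nat.factorial_succ, Nat.add_sub_cancel, Nat.cast_mul]
        have : ((j + 1 : ℕ) : ℝ) ≠ 0 := by positivity
        field_simp
    -- The difference vanishes at `0`, and the induction hypotheses at `p` and `p + 1` make its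
    -- derivative nonnegative.
    have hmono : MonotoneOn f (Set.Ici 0) := by
      refine monotoneOn_of_deriv_nonneg (convex_Ici 0)
        (fun s _ => (hf s).continuousAt.continuousWithinAt)
        (fun s _ => (hf s).differentiableAt.differentiableWithinAt) fun s hs => ?_
      rw [interior_Ici] at hs
      have hs : 0 ≤ s := le_of_lt hs
      rw [(hf s).deriv, sub_nonneg]
      have e : ∑ j ∈ Finset.range N, growthCoeff a μ (j + 1) p * (s ^ j / j.factorial) =
          (a + μ * p) * ∑ j ∈ Finset.range N, growthCoeff a μ j p * (s ^ j / j.factorial) +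
          μ * ∑ j ∈ Finset.range N, growthCoeff a μ j (p + 1) * (s ^ j / j.factorial) := by
        rw [Finset.mul_sum, Finset.mul_sum, ← Finset.sum_add_distrib]
        refine Finset.sum_congr rfl fun j _ => ?_
        simp only [growthCoeff]
        ring
      have e2 : Real.exp ((a + μ * (p + 1 : ℕ)) * s + (Real.exp (μ * s) - 1)) =
          Real.exp ((a + μ * p) * s + (Real.exp (μ * s) - 1)) * Real.exp (μ * s) := by
        rw [← Real.exp_add]
        congr 1
        push_cast
        ring
      have h1 := ih p hs
      have h2 := ih (p + 1) hs
      rw [e2] at h2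
      rw [e]
      calc _ ≤ (a + μ * p) * Real.exp ((a + μ * p) * s + (Real.exp (μ * s) - 1)) +
            μ * (Real.exp ((a + μ * p) * s + (Real.exp (μ * s) - 1)) * Real.exp (μ * s)) := by
            gcongr
        _ = _ := by ring
    have h0 : f 0 = 0 := by
      simp [f, Finset.sum_range_succ', growthCoeff]
    have := hmono (Set.mem_Ici.2 le_rfl) (Set.mem_Ici.2 hs) hs
    rw [h0] at this
    exact sub_nonneg.1 this

lemma summable_growthCoeff {a μ : ℝ} (ha : 0 ≤ a) (hμ : 0 ≤ μ) (p : ℕ) {s : ℝ} (hs : 0 ≤ s) :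
    Summable fun j : ℕ => growthCoeff a μ j p * (s ^ j / j.factorial) :=
  summable_of_sum_range_le
    (fun j => mul_nonneg (growthCoeff_nonneg ha hμ j p) (by positivity))
    fun N => sum_growthCoeff_le ha hμ N p hs

lemma tsum_growthCoeff_le {a μ : ℝ} (ha : 0 ≤ a) (hμ : 0 ≤ μ) (p : ℕ) {s : ℝ} (hs : 0 ≤ s) :
    ∑' j : ℕ, growthCoeff a μ j p * (s ^ j / j.factorial) ≤
      Real.exp ((a + μ * p) * s + (Real.exp (μ * s) - 1)) :=
  Real.tsum_le_of_sum_range_le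
    (fun j => mul_nonneg (growthCoeff_nonneg ha hμ j p) (by positivity))
    fun N => sum_growthCoeff_le ha hμ N p hs

namespace SpinChain
open NormedSpace BanachConj

/-! ## Localized observables -/

section
variable {d : ℕ} {Λ Λ₁ Λ₂ : Finset ℤ}

/-- Only one intermediate configuration contributes to the matrix product: the one equal to `η` on
`Λ₁` and to `σ` elsewhere. -/
lemma extendMat_mul_extendMat_of_disjoint (h₁ : Λ₁ ⊆ Λ) (h₂ : Λ₂ ⊆ Λ) (hd : Disjoint Λ₁ Λ₂)
    (M : RegionAlg d Λ₁) (N : RegionAlg d Λ₂) (σ η : Λ → Fin d) :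
    (extendMat h₁ M * extendMat h₂ N) σ η = extendMat h₁ M σ (glue σ (restr h₁ η)) *
      extendMat h₂ N (glue σ (restr h₁ η)) η := by
  classical
  rw [Matrix.mul_apply]
  refine Finset.sum_eq_single_of_mem _ (Finset.mem_univ _) fun κ _ hκ => ?_
  by_contra hne
  have h1 : AgreeOff Λ₁ σ κ := by
    by_contra h; exact hne (by simp [extendMat, h])
  have h2 : AgreeOff Λ₂ κ η := by
    by_contra h; exact hne (by simp [extendMat, h])
  refine hκ ?_
  rw [← glue_restr h₁ h1]
  congr 1
  funext x
  exact h2 ⟨x.1, h₁ x.2⟩ (Finset.disjoint_left.1 hd x.2)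

lemma commute_extend_of_disjoint (h₁ : Λ₁ ⊆ Λ) (h₂ : Λ₂ ⊆ Λ) (hd : Disjoint Λ₁ Λ₂)
    (M : RegionAlg d Λ₁) (N : RegionAlg d Λ₂) : Commute (extend d h₁ M) (extend d h₂ N) := by
  classical
  ext σ η
  rw [extend_apply, extend_apply, extendMat_mul_extendMat_of_disjoint h₁ h₂ hd,
    extendMat_mul_extendMat_of_disjoint h₂ h₁ hd.symm, mul_comm]
  have r1 : restr h₂ (glue σ (restr h₁ η)) = restr h₂ σ := by
    funext x
    simp [restr, glue, Finset.disjoint_right.1 hd x.2]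
  have r2 : restr h₁ (glue σ (restr h₂ η)) = restr h₁ σ := by
    funext x
    simp [restr, glue, Finset.disjoint_left.1 hd x.2]
  have a1 : AgreeOff Λ₁ σ (glue σ (restr h₁ η)) := agreeOff_glue _ _
  have a2 : AgreeOff Λ₂ σ (glue σ (restr h₂ η)) := agreeOff_glue _ _
  have a3 : AgreeOff Λ₂ (glue σ (restr h₁ η)) η ↔ AgreeOff Λ₁ (glue σ (restr h₂ η)) η := by
    constructor
    · intro H x hx
      by_cases hx2 : x.1 ∈ Λ₂
      · simp [glue, hx2, restr]
      · have := H x hx2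
        simp only [glue, hx, dite_false] at this
        simpa [glue, hx2] using this
    · intro H x hx
      by_cases hx1 : x.1 ∈ Λ₁
      · simp [glue, hx1, restr]
      · have := H x hx1
        simp only [glue, hx, dite_false] at this
        simpa [glue, hx1] using this
  simp only [extendMat, a1, a2, if_true, restr_glue, a3, r1, r2]
  split_ifs
  · ring
  · ring

end

namespace Interaction

/-- The terms of the sets with two points at distance more than `R` vanish. -/
def RangeLE {d : ℕ} (Φ : Interaction d) (R : ℕ) : Prop :=
  ∀ X : Finset ℤ, ∀ x ∈ X, ∀ y ∈ X, (R : ℤ) < y - x → Φ.term X = 0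

lemma HasRange.rangeLE {d : ℕ} {Φ : Interaction d} {r : ℝ} (h : Φ.HasRange r) : Φ.RangeLE ⌈r⌉₊ := by
  intro X x hx y hy hxy
  refine h X ?_
  have h1 : dist x y ≤ Metric.diam (X : Set ℤ) :=
    Metric.dist_le_diam_of_mem X.finite_toSet.isBounded hx hy
  have h2 : ((⌈r⌉₊ : ℤ) : ℝ) < ((y - x : ℤ) : ℝ) := Int.cast_lt.2 hxy
  have h3 : ((y - x : ℤ) : ℝ) ≤ dist x y := by
    rw [Int.dist_eq, abs_sub_comm]
    push_cast
    exact le_abs_self _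
  have h4 := Nat.le_ceil r
  push_cast at h2 h3
  linarith

end Interaction

variable {d : ℕ} [NeZero d]

lemma embed_extend {Λ Λ' : Finset ℤ} (h : Λ ⊆ Λ') (M : RegionAlg d Λ) :
    embed d Λ' (extend d h M) = embed d Λ M :=
  congrArg (QuasiLocalAlg.ofLocal d) (LocalAlg.of_extend h M)

lemma norm_embed (Λ : Finset ℤ) (M : RegionAlg d Λ) : ‖embed d Λ M‖ = ‖M‖ :=
  QuasiLocalAlg.norm_ofLocal _

lemma continuous_embed (Λ : Finset ℤ) : Continuous (embed d Λ) :=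
  (AddMonoidHomClass.isometry_of_norm (embed d Λ) (norm_embed Λ)).continuous

variable (d) in
/-- The observables localized in `Λ`, as a subalgebra of `𝔄_ℤ`. -/
def Loc (Λ : Finset ℤ) : Subalgebra ℂ (QuasiLocalAlg d) := (embed d Λ).toAlgHom.range

lemma mem_Loc {Λ : Finset ℤ} {Q : QuasiLocalAlg d} :
    Q ∈ Loc d Λ ↔ ∃ M : RegionAlg d Λ, embed d Λ M = Q :=
  Iff.rfl

lemma embed_mem_Loc {Λ : Finset ℤ} (M : RegionAlg d Λ) : embed d Λ M ∈ Loc d Λ := ⟨M, rfl⟩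

lemma Loc_mono {Λ Λ' : Finset ℤ} (h : Λ ⊆ Λ') : Loc d Λ ≤ Loc d Λ' := by
  rintro _ ⟨M, rfl⟩
  exact ⟨extend d h M, embed_extend h M⟩

lemma commute_of_disjoint {Λ₁ Λ₂ : Finset ℤ} (hd : Disjoint Λ₁ Λ₂) {P Q : QuasiLocalAlg d}
    (hP : P ∈ Loc d Λ₁) (hQ : Q ∈ Loc d Λ₂) : Commute P Q := by
  obtain ⟨M, rfl⟩ := mem_Loc.1 hP
  obtain ⟨N, rfl⟩ := mem_Loc.1 hQ
  rw [← embed_extend (Finset.subset_union_left (s₁ := Λ₁) (s₂ := Λ₂)) M,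
    ← embed_extend (Finset.subset_union_right (s₁ := Λ₁) (s₂ := Λ₂)) N]
  exact (commute_extend_of_disjoint _ _ hd M N).map (embed d (Λ₁ ∪ Λ₂))

lemma embed_exp {Λ : Finset ℤ} (M : RegionAlg d Λ) : embed d Λ (exp M) = exp (embed d Λ M) :=
  let _ : NormedAlgebra ℚ (RegionAlg d Λ) := NormedAlgebra.restrictScalars ℚ ℂ _
  let _ : NormedAlgebra ℚ (QuasiLocalAlg d) := NormedAlgebra.restrictScalars ℚ ℂ _
  map_exp (embed d Λ) (continuous_embed Λ) M

lemma exp_mem_Loc {Λ : Finset ℤ} {Q : QuasiLocalAlg d} (hQ : Q ∈ Loc d Λ) :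
    exp Q ∈ Loc d Λ := by
  obtain ⟨M, rfl⟩ := mem_Loc.1 hQ
  exact ⟨exp M, embed_exp M⟩

/-! ## Hamiltonians in the quasi-local algebra -/

namespace Interaction
variable (Φ : Interaction d)

/-- The interaction term of `X` as a quasi-local observable. -/
def qterm (X : Finset ℤ) : QuasiLocalAlg d := embed d X (Φ.term X)

/-- The Hamiltonian of `Λ` as a quasi-local observable. -/
def qham (Λ : Finset ℤ) : QuasiLocalAlg d := ∑ X ∈ Λ.powerset, Φ.qterm X

lemma embed_hamiltonian (Λ : Finset ℤ) : embed d Λ (Φ.hamiltonian Λ) = Φ.qham Λ := by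
  rw [hamiltonian, map_sum, qham, ← Finset.sum_attach Λ.powerset]
  exact Finset.sum_congr rfl fun X _ => embed_extend _ _

lemma isSelfAdjoint_qterm (X : Finset ℤ) : IsSelfAdjoint (Φ.qterm X) :=
  (Φ.isSelfAdjoint X).map (embed d X)

lemma isSelfAdjoint_qham (Λ : Finset ℤ) : IsSelfAdjoint (Φ.qham Λ) :=
  isSelfAdjoint_sum _ fun X _ => Φ.isSelfAdjoint_qterm X

lemma qterm_mem (X : Finset ℤ) : Φ.qterm X ∈ Loc d X := embed_mem_Loc _

lemma qham_mem (Λ : Finset ℤ) : Φ.qham Λ ∈ Loc d Λ :=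
  Subalgebra.sum_mem _ fun X hX => Loc_mono (Finset.mem_powerset.1 hX) (Φ.qterm_mem X)

variable {Φ}

lemma RangeLE.subset_Icc {R : ℕ} (h : Φ.RangeLE R) {X : Finset ℤ} (hX : Φ.qterm X ≠ 0) {z : ℤ}
    (hz : z ∈ X) : X ⊆ Finset.Icc (z - R) (z + R) := by
  intro w hw
  have hX : Φ.term X ≠ 0 := fun h => hX (by simp [qterm, h])
  rw [Finset.mem_Icc]
  constructor
  · by_contra hlt
    exact hX (h X w hw z hz (by omega))
  · by_contra hlt
    exact hX (h X z hz w hw (by omega))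

lemma HasStrength.norm_qterm_le {J : ℝ} (h : Φ.HasStrength J) (X : Finset ℤ) :
    ‖Φ.qterm X‖ ≤ J := (norm_embed X _).trans_le (h X)

lemma adL_qterm_eq_zero_of_disjoint {X S : Finset ℤ} (hd : Disjoint X S) {Q : QuasiLocalAlg d}
    (hQ : Q ∈ Loc d S) : adL (Φ.qterm X) Q = 0 := by
  rw [adL_apply, sub_eq_zero]
  exact commute_of_disjoint hd (Φ.qterm_mem X) hQ

lemma exists_mem_of_adL_qterm_ne_zero {X S : Finset ℤ} {Q : QuasiLocalAlg d}
    (hQ : Q ∈ Loc d S) (h : adL (Φ.qterm X) Q ≠ 0) : (∃ z ∈ X, z ∈ S) ∧ Φ.qterm X ≠ 0 := by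
  refine ⟨?_, fun h0 => h (by simp [adL_apply, h0])⟩
  by_contra hne
  push Not at hne
  exact h (adL_qterm_eq_zero_of_disjoint (Finset.disjoint_left.2 hne) hQ)

lemma adL_qham (Λ : Finset ℤ) (Q : QuasiLocalAlg d) :
    adL (Φ.qham Λ) Q = ∑ X ∈ Λ.powerset, adL (Φ.qterm X) Q := by
  simp [adL_apply, qham, Finset.sum_mul, Finset.mul_sum]

lemma adL_mem {S : Finset ℤ} {P Q : QuasiLocalAlg d} (hP : P ∈ Loc d S) (hQ : Q ∈ Loc d S) :
    adL P Q ∈ Loc d S :=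
  Subalgebra.sub_mem _ (Subalgebra.mul_mem _ hP hQ) (Subalgebra.mul_mem _ hQ hP)

lemma norm_adL_le (P Q : QuasiLocalAlg d) : ‖adL P Q‖ ≤ 2 * ‖P‖ * ‖Q‖ := by
  rw [adL_apply]
  have h1 := norm_mul_le P Q
  have h2 := norm_mul_le Q P
  have := norm_sub_le (P * Q) (Q * P)
  nlinarith

lemma norm_sum_adL_le {J : ℝ} (hJ : 0 ≤ J) (hs : Φ.HasStrength J) (S T : Finset (Finset ℤ))
    (Q : QuasiLocalAlg d) (h : ∀ X ∈ S, adL (Φ.qterm X) Q ≠ 0 → X ∈ T) :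
    ‖∑ X ∈ S, adL (Φ.qterm X) Q‖ ≤ T.card * (2 * J * ‖Q‖) := by
  classical
  have : ∑ X ∈ S, adL (Φ.qterm X) Q = ∑ X ∈ S with X ∈ T, adL (Φ.qterm X) Q :=
    (Finset.sum_filter_of_ne fun X hX hne => h X hX hne).symm
  rw [this]
  refine (norm_sum_le _ _).trans ?_
  refine (Finset.sum_le_card_nsmul _ _ (2 * J * ‖Q‖) fun X _ => ?_).trans ?_
  · refine (norm_adL_le _ _).trans ?_
    gcongr
    exact hs.norm_qterm_le X
  · rw [nsmul_eq_mul]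
    have : (S.filter (· ∈ T)).card ≤ T.card :=
      Finset.card_le_card fun X hX => (Finset.mem_filter.1 hX).2
    gcongr

lemma card_powerset_Icc (z : ℤ) (R : ℕ) :
    (Finset.Icc (z - R) (z + R)).powerset.card = 2 ^ (2 * R + 1) := by
  rw [Finset.card_powerset, Int.card_Icc]
  congr 1
  omega

/-- A term that meets the interval either lies inside it, and these are counted by sites, or sticks
out, and then the range confines it to distance `R` from an end point. The second norm therefore
does not grow with the length of the interval; this is where one-dimensionality enters. -/
lemma exists_adL_qham_split {R : ℕ} {J : ℝ} (hJ : 0 ≤ J) (hr : Φ.RangeLE R)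
    (hs : Φ.HasStrength J) (Λ : Finset ℤ) {x y : ℤ} {Q : QuasiLocalAlg d}
    (hQ : Q ∈ Loc d (Finset.Icc x y)) :
    ∃ Q₁ Q₂, adL (Φ.qham Λ) Q = Q₁ + Q₂ ∧ Q₁ ∈ Loc d (Finset.Icc x y) ∧
      Q₂ ∈ Loc d (Finset.Icc (x - R) (y + R)) ∧
      ‖Q₁‖ ≤ 2 * (2 ^ (2 * R + 1) * J) * (Finset.Icc x y).card * ‖Q‖ ∧
      ‖Q₂‖ ≤ 4 * (2 ^ (2 * R + 1) * J) * ‖Q‖ := by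
  classical
  refine ⟨∑ X ∈ Λ.powerset with X ⊆ Finset.Icc x y, adL (Φ.qterm X) Q,
    ∑ X ∈ Λ.powerset with ¬ X ⊆ Finset.Icc x y, adL (Φ.qterm X) Q, ?_, ?_, ?_, ?_, ?_⟩
  · rw [adL_qham, Finset.sum_filter_add_sum_filter_not]
  · exact Subalgebra.sum_mem _ fun X hX =>
      adL_mem (Loc_mono (Finset.mem_filter.1 hX).2 (Φ.qterm_mem X)) hQ
  · refine Subalgebra.sum_mem _ fun X hX => ?_
    by_cases hne : adL (Φ.qterm X) Q = 0
    · rw [hne]; exact Subalgebra.zero_mem _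
    obtain ⟨⟨z, hz, hz'⟩, h0⟩ := exists_mem_of_adL_qterm_ne_zero hQ hne
    rw [Finset.mem_Icc] at hz'
    refine adL_mem (Loc_mono ((hr.subset_Icc h0 hz).trans ?_) (Φ.qterm_mem X)) (Loc_mono ?_ hQ)
    · exact Finset.Icc_subset_Icc (by omega) (by omega)
    · exact Finset.Icc_subset_Icc (by omega) (by omega)
  · refine (norm_sum_adL_le hJ hs _
      ((Finset.Icc x y).biUnion fun z => (Finset.Icc (z - (R : ℤ)) (z + R)).powerset) Q ?_).trans ?_
    · intro X _ hne
      obtain ⟨⟨z, hz, hz'⟩, h0⟩ := exists_mem_of_adL_qterm_ne_zero hQ hne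
      exact Finset.mem_biUnion.2 ⟨z, hz', Finset.mem_powerset.2 (hr.subset_Icc h0 hz)⟩
    · have hc : ((Finset.Icc x y).biUnion
          fun z => (Finset.Icc (z - (R : ℤ)) (z + R)).powerset).card ≤
          (Finset.Icc x y).card * 2 ^ (2 * R + 1) :=
        Finset.card_biUnion_le_card_mul _ _ _ fun z _ => (card_powerset_Icc z R).le
      have hc' := (Nat.cast_le (α := ℝ)).2 hc
      push_cast at hc'
      calc _ ≤ ((Finset.Icc x y).card * 2 ^ (2 * R + 1) : ℝ) * (2 * J * ‖Q‖) := by gcongr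
        _ = _ := by ring
  · refine (norm_sum_adL_le hJ hs _
      ((Finset.Icc (x - (R : ℤ)) (x + R)).powerset ∪
        (Finset.Icc (y - (R : ℤ)) (y + R)).powerset) Q ?_).trans ?_
    · intro X hX hne
      obtain ⟨⟨z, hz, hz'⟩, h0⟩ := exists_mem_of_adL_qterm_ne_zero hQ hne
      obtain ⟨w, hw, hw'⟩ := Finset.not_subset.1 (Finset.mem_filter.1 hX).2
      have s1 := hr.subset_Icc h0 hz
      have s2 := hr.subset_Icc h0 hw
      rw [Finset.mem_Icc] at hz' hw'
      rw [Finset.mem_union, Finset.mem_powerset, Finset.mem_powerset]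
      rcases lt_or_ge w x with hwx | hwx
      · left
        intro u hu
        have h1 := Finset.mem_Icc.1 (s1 hu)
        have h2 := Finset.mem_Icc.1 (s2 hu)
        rw [Finset.mem_Icc]
        omega
      · right
        intro u hu
        have h1 := Finset.mem_Icc.1 (s1 hu)
        have h2 := Finset.mem_Icc.1 (s2 hu)
        rw [Finset.mem_Icc]
        omega
    · have hc : (((Finset.Icc (x - (R : ℤ)) (x + R)).powerset ∪
        (Finset.Icc (y - (R : ℤ)) (y + R)).powerset).card : ℝ) ≤ 2 * 2 ^ (2 * R + 1) := by
        have := Finset.card_union_le (Finset.Icc (x - (R : ℤ)) (x + R)).powerset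
          (Finset.Icc (y - (R : ℤ)) (y + R)).powerset
        rw [card_powerset_Icc, card_powerset_Icc] at this
        have h := (Nat.cast_le (α := ℝ)).2 this
        push_cast at h
        linarith
      calc _ ≤ (2 * 2 ^ (2 * R + 1) : ℝ) * (2 * J * ‖Q‖) := by gcongr
        _ = _ := by ring

end Interaction
end SpinChain

end

/-! ### Araki's bound and the locality of the complex time evolution. -/

noncomputable section

namespace SpinChain
open NormedSpace BanachConj

/-- The sum of the majorant series. -/
def growthBound (a μ s : ℝ) : ℝ := Real.exp (a * s + (Real.exp (μ * s) - 1))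

lemma growthBound_pos (a μ s : ℝ) : 0 < growthBound a μ s := Real.exp_pos _

lemma growthBound_mono {a μ s t : ℝ} (ha : 0 ≤ a) (hμ : 0 ≤ μ) (hst : s ≤ t) :
    growthBound a μ s ≤ growthBound a μ t := by
  unfold growthBound
  gcongr

/-- A bound on the norm of the sum of all the terms supported in a neighbourhood of a site. -/
def siteStrength (R : ℕ) (J : ℝ) : ℝ := 2 ^ (2 * R + 1) * J

lemma siteStrength_pos (R : ℕ) {J : ℝ} (hJ : 0 < J) : 0 < siteStrength R J := by
  unfold siteStrength; positivity

namespace Interaction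
variable {d : ℕ} [NeZero d] {Φ : Interaction d} {R : ℕ} {J : ℝ}

lemma card_Icc_enlarge {x y : ℤ} (hxy : x ≤ y) (p R : ℕ) :
    ((Finset.Icc (x - (p * R : ℕ)) (y + (p * R : ℕ))).card : ℝ) =
      (Finset.Icc x y).card + 2 * p * R := by
  have : (Finset.Icc (x - (p * R : ℕ)) (y + (p * R : ℕ))).card =
      (Finset.Icc x y).card + 2 * (p * R) := by
    rw [Int.card_Icc, Int.card_Icc]
    generalize p * R = m
    omega
  rw [this]
  push_cast
  ring

/-- **Araki's bound** on iterated commutators with a one-dimensional Hamiltonian. -/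
lemma norm_adL_pow_le (hJ : 0 < J) (hR : 1 ≤ R) (hr : Φ.RangeLE R) (hs : Φ.HasStrength J)
    (Λ : Finset ℤ) {x y : ℤ} (hxy : x ≤ y) (j p : ℕ) {Q : QuasiLocalAlg d}
    (hQ : Q ∈ Loc d (Finset.Icc (x - (p * R : ℕ)) (y + (p * R : ℕ)))) :
    ‖(adL (Φ.qham Λ) ^ j) Q‖ ≤
      growthCoeff (2 * siteStrength R J * (Finset.Icc x y).card) (4 * siteStrength R J * R) j p *
        ‖Q‖ := by
  have hG := siteStrength_pos R hJ
  induction j generalizing p Q with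
  | zero => simp [growthCoeff]
  | succ j ih =>
    -- `Q₁` keeps `p` and `Q₂` raises it to `p + 1`. With `G = siteStrength R J` and `μ = 4 G R`,
    -- the enlarged cardinality makes the first factor `a + μ p`, and `4 G ≤ μ` since `1 ≤ R`.
    obtain ⟨Q₁, Q₂, e, h1, h2, n1, n2⟩ := exists_adL_qham_split hJ.le hr hs Λ hQ
    rw [pow_succ, mul_apply_eq_comp, e, map_add]
    have h2' : Q₂ ∈ Loc d (Finset.Icc (x - ((p + 1) * R : ℕ)) (y + ((p + 1) * R : ℕ))) := by
      convert h2 using 3 <;> push_cast <;> ring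
    rw [card_Icc_enlarge hxy] at n1
    change _ ≤ 2 * siteStrength R J * _ * _ at n1
    change _ ≤ 4 * siteStrength R J * _ at n2
    have hR' : (1 : ℝ) ≤ R := by exact_mod_cast hR
    have n2' : ‖Q₂‖ ≤ 4 * siteStrength R J * R * ‖Q‖ := by
      refine n2.trans ?_
      have : 4 * siteStrength R J * 1 ≤ 4 * siteStrength R J * R := by gcongr
      rw [mul_one] at this
      gcongr
    have k1 := ih p h1
    have k2 := ih (p + 1) h2'
    have c1 := growthCoeff_nonneg (a := 2 * siteStrength R J * (Finset.Icc x y).card)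
      (μ := 4 * siteStrength R J * R) (by positivity) (by positivity) j p
    have c2 := growthCoeff_nonneg (a := 2 * siteStrength R J * (Finset.Icc x y).card)
      (μ := 4 * siteStrength R J * R) (by positivity) (by positivity) j (p + 1)
    refine (norm_add_le _ _).trans ((add_le_add (k1.trans (mul_le_mul_of_nonneg_left n1 c1))
      (k2.trans (mul_le_mul_of_nonneg_left n2' c2))).trans (le_of_eq ?_))
    simp only [growthCoeff]
    ring

lemma adL_qham_eq (hr : Φ.RangeLE R) {Λ Λ' : Finset ℤ} {x y : ℤ} {Q : QuasiLocalAlg d}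
    (hQ : Q ∈ Loc d (Finset.Icc x y))
    (h : ∀ z, x - R ≤ z → z ≤ y + R → (z ∈ Λ ↔ z ∈ Λ')) :
    adL (Φ.qham Λ) Q = adL (Φ.qham Λ') Q := by
  classical
  have key : ∀ {Λ Λ' : Finset ℤ}, (∀ z, x - R ≤ z → z ≤ y + R → (z ∈ Λ ↔ z ∈ Λ')) →
      ∀ X ∈ Λ.powerset, adL (Φ.qterm X) Q ≠ 0 → X ∈ Λ'.powerset := by
    intro Λ Λ' h X hX hne
    obtain ⟨⟨z, hz, hz'⟩, h0⟩ := exists_mem_of_adL_qterm_ne_zero hQ hne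
    rw [Finset.mem_Icc] at hz'
    rw [Finset.mem_powerset] at hX ⊢
    intro w hw
    have := Finset.mem_Icc.1 (hr.subset_Icc h0 hz hw)
    exact (h w (by omega) (by omega)).1 (hX hw)
  rw [adL_qham, adL_qham, ← Finset.sum_filter_of_ne (p := fun X => X ∈ Λ'.powerset) (key h),
    ← Finset.sum_filter_of_ne (s := Λ'.powerset) (p := fun X => X ∈ Λ.powerset)
      (key fun z hz hz' => (h z hz hz').symm)]
  refine Finset.sum_congr ?_ fun _ _ => rfl
  ext X
  simp [and_comm]

lemma adL_qham_mem (hJ : 0 < J) (hr : Φ.RangeLE R) (hs : Φ.HasStrength J)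
    (Λ : Finset ℤ) {x y : ℤ} {Q : QuasiLocalAlg d} (hQ : Q ∈ Loc d (Finset.Icc x y)) :
    adL (Φ.qham Λ) Q ∈ Loc d (Finset.Icc (x - R) (y + R)) := by
  obtain ⟨Q₁, Q₂, e, h1, h2, -, -⟩ := exists_adL_qham_split hJ.le hr hs Λ hQ
  rw [e]
  exact Subalgebra.add_mem _
    (Loc_mono (Finset.Icc_subset_Icc (by omega) (by omega)) h1) h2

/-- Each commutator sees only `R` further sites on either side. -/
lemma adL_pow_qham_eq (hJ : 0 < J) (hr : Φ.RangeLE R) (hs : Φ.HasStrength J)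
    {Λ Λ' : Finset ℤ} (j : ℕ) {x y : ℤ} {Q : QuasiLocalAlg d}
    (hQ : Q ∈ Loc d (Finset.Icc x y))
    (h : ∀ z, x - (j * R : ℕ) ≤ z → z ≤ y + (j * R : ℕ) → (z ∈ Λ ↔ z ∈ Λ')) :
    (adL (Φ.qham Λ) ^ j) Q = (adL (Φ.qham Λ') ^ j) Q := by
  induction j generalizing x y Q with
  | zero => simp
  | succ j ih =>
    have e : (j + 1) * R = j * R + R := by ring
    rw [e] at h
    push_cast at h
    rw [pow_succ, pow_succ, mul_apply_eq_comp, mul_apply_eq_comp,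
      ih (adL_qham_mem hJ hr hs Λ hQ) fun z hz hz' => ?_, adL_qham_eq hr hQ fun z hz hz' => ?_]
    · have : (0 : ℤ) ≤ j * R := by positivity
      exact h z (by linarith) (by linarith)
    · push_cast at hz hz'
      exact h z (by linarith) (by linarith)

section bounds
variable (hJ : 0 < J) (hR : 1 ≤ R) (hr : Φ.RangeLE R) (hs : Φ.HasStrength J)
include hJ hR hr hs

lemma norm_term_le (Λ : Finset ℤ) {x y : ℤ} (hxy : x ≤ y) {Q : QuasiLocalAlg d}
    (hQ : Q ∈ Loc d (Finset.Icc x y)) (z : ℂ) (j : ℕ) :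
    ‖(z ^ j / j.factorial : ℂ) • (adL (Φ.qham Λ) ^ j) Q‖ ≤
      growthCoeff (2 * siteStrength R J * (Finset.Icc x y).card) (4 * siteStrength R J * R) j 0 *
        (‖z‖ ^ j / j.factorial) * ‖Q‖ := by
  have := norm_adL_pow_le hJ hR hr hs Λ hxy j 0 (Q := Q) (by simpa using hQ)
  rw [norm_smul, norm_div, norm_pow, Complex.norm_natCast]
  calc _ ≤ ‖z‖ ^ j / j.factorial * (growthCoeff (2 * siteStrength R J * (Finset.Icc x y).card)
        (4 * siteStrength R J * R) j 0 * ‖Q‖) := by gcongr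
    _ = _ := by ring

lemma norm_conjExp_qham_le (Λ : Finset ℤ) {x y : ℤ} (hxy : x ≤ y) {Q : QuasiLocalAlg d}
    (hQ : Q ∈ Loc d (Finset.Icc x y)) (z : ℂ) :
    ‖conjExp z (Φ.qham Λ) Q‖ ≤
      growthBound (2 * siteStrength R J * (Finset.Icc x y).card) (4 * siteStrength R J * R) ‖z‖ *
        ‖Q‖ := by
  have hG := siteStrength_pos R hJ
  have hsum := (summable_growthCoeff
    (a := 2 * siteStrength R J * (Finset.Icc x y).card) (μ := 4 * siteStrength R J * R)
    (by positivity) (by positivity) 0 (norm_nonneg z)).hasSum.mul_right ‖Q‖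
  rw [← (hasSum_conjExp z (Φ.qham Λ) Q).tsum_eq]
  refine (tsum_of_norm_bounded hsum fun j => norm_term_le hJ hR hr hs Λ hxy hQ z j).trans ?_
  refine mul_le_mul_of_nonneg_right ?_ (norm_nonneg _)
  simpa [growthBound] using tsum_growthCoeff_le
    (a := 2 * siteStrength R J * (Finset.Icc x y).card) (μ := 4 * siteStrength R J * R)
    (by positivity) (by positivity) 0 (norm_nonneg z)

/-- Locality of the complex time evolution. -/
lemma norm_conjExp_qham_sub_le {Λ Λ' : Finset ℤ} {x y : ℤ} (hxy : x ≤ y) {Q : QuasiLocalAlg d}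
    (hQ : Q ∈ Loc d (Finset.Icc x y)) (N : ℕ)
    (h : ∀ z, x - (N * R : ℕ) ≤ z → z ≤ y + (N * R : ℕ) → (z ∈ Λ ↔ z ∈ Λ')) (z : ℂ) {l : ℝ}
    (hl : 0 ≤ l) :
    ‖conjExp z (Φ.qham Λ) Q - conjExp z (Φ.qham Λ') Q‖ ≤
      2 * Real.exp (-(l * N)) *
        growthBound (2 * siteStrength R J * (Finset.Icc x y).card) (4 * siteStrength R J * R)
          (‖z‖ * Real.exp l) * ‖Q‖ := by
  have hG := siteStrength_pos R hJ
  set a := 2 * siteStrength R J * (Finset.Icc x y).card with ha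
  set μ := 4 * siteStrength R J * R with hμ
  have ha0 : 0 ≤ a := by positivity
  have hμ0 : 0 ≤ μ := by positivity
  have hz : 0 ≤ ‖z‖ * Real.exp l := by positivity
  have hsum := ((summable_growthCoeff ha0 hμ0 0 hz).hasSum.mul_left
    (2 * Real.exp (-(l * N)))).mul_right ‖Q‖
  rw [← ((hasSum_conjExp z (Φ.qham Λ) Q).sub (hasSum_conjExp z (Φ.qham Λ') Q)).tsum_eq]
  refine (tsum_of_norm_bounded hsum fun j => ?_).trans ?_
  · have hc := growthCoeff_nonneg ha0 hμ0 j 0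
    -- The terms up to `N` cancel. In the later ones a factor `exp (l (j - N)) ≥ 1` is inserted: the
    -- price of the decay `exp (-l N)` is evaluating the majorant at `‖z‖ * exp l`. The majorant
    -- converges everywhere, so the rate `l` is free.
    rcases le_or_gt j N with hj | hj
    · have hjR : (j * R : ℕ) ≤ N * R := Nat.mul_le_mul_right R hj
      have hjR' : ((j * R : ℕ) : ℤ) ≤ (N * R : ℕ) := by exact_mod_cast hjR
      rw [adL_pow_qham_eq hJ hr hs j hQ fun z hz hz' => h z (by linarith) (by linarith), sub_self,
        norm_zero]
      positivity
    · have n1 := norm_term_le hJ hR hr hs Λ hxy hQ z j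
      have n2 := norm_term_le hJ hR hr hs Λ' hxy hQ z j
      rw [← ha, ← hμ] at n1 n2
      have e1 : ‖z‖ ^ j ≤ Real.exp (-(l * N)) * (‖z‖ * Real.exp l) ^ j := by
        rw [mul_pow, ← Real.exp_nat_mul, mul_left_comm, ← Real.exp_add]
        refine le_mul_of_one_le_right (by positivity) (Real.one_le_exp ?_)
        have : (N : ℝ) ≤ j := by exact_mod_cast hj.le
        nlinarith
      calc _ ≤ growthCoeff a μ j 0 * (‖z‖ ^ j / j.factorial) * ‖Q‖ +
            growthCoeff a μ j 0 * (‖z‖ ^ j / j.factorial) * ‖Q‖ :=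
            (norm_sub_le _ _).trans (add_le_add n1 n2)
        _ = 2 * (growthCoeff a μ j 0 * (‖z‖ ^ j / j.factorial) * ‖Q‖) := by ring
        _ ≤ 2 * (growthCoeff a μ j 0 * (Real.exp (-(l * N)) * (‖z‖ * Real.exp l) ^ j /
            j.factorial) * ‖Q‖) := by gcongr
        _ = _ := by ring
  · refine mul_le_mul_of_nonneg_right (mul_le_mul_of_nonneg_left ?_ (by positivity))
      (norm_nonneg _)
    simpa [growthBound] using tsum_growthCoeff_le ha0 hμ0 0 hz

end bounds

/-! ## Cutting a Hamiltonian at a site -/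

/-- The terms of the Hamiltonian that couple the two half-lines separated at `p` (up to a scalar). -/
def cut (Φ : Interaction d) (p : ℤ) (Λ : Finset ℤ) : QuasiLocalAlg d :=
  Φ.qham Λ - (Φ.qham (Λ.filter (· < p)) + Φ.qham (Λ.filter (p ≤ ·)))

-- The two halves share only the subset `∅`, which is thus counted twice; all other missing terms
-- straddle `p` and lie within `R` of it. So the cut is local and bounded uniformly in `Λ`.
open Classical in
lemma cut_eq (hr : Φ.RangeLE R) (p : ℤ) (Λ : Finset ℤ) :
    Φ.cut p Λ = (∑ X ∈ (Finset.Icc (p - R) (p + R)).powerset with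
      X ⊆ Λ ∧ (∃ x ∈ X, x < p) ∧ ∃ x ∈ X, p ≤ x, Φ.qterm X) - Φ.qterm ∅ := by
  set L := (Λ.filter (· < p)).powerset
  set L' := (Λ.filter (p ≤ ·)).powerset
  have hi : L ∩ L' = {∅} := by
    ext X
    simp only [L, L', Finset.mem_inter, Finset.mem_powerset, Finset.mem_singleton]
    constructor
    · rintro ⟨h1, h2⟩
      refine Finset.eq_empty_of_forall_notMem fun x hx => ?_
      have := (Finset.mem_filter.1 (h1 hx)).2
      have := (Finset.mem_filter.1 (h2 hx)).2
      omega
    · rintro rfl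
      simp
  have hu := Finset.sum_union_inter (s₁ := L) (s₂ := L') (f := Φ.qterm)
  rw [hi, Finset.sum_singleton] at hu
  have hs : L ∪ L' ⊆ Λ.powerset :=
    Finset.union_subset (Finset.powerset_mono.2 (Finset.filter_subset _ _))
      (Finset.powerset_mono.2 (Finset.filter_subset _ _))
  have hsd := Finset.sum_sdiff (f := Φ.qterm) hs
  have hmain : ∑ X ∈ Λ.powerset \ (L ∪ L'), Φ.qterm X =
      ∑ X ∈ (Finset.Icc (p - R) (p + R)).powerset with
        X ⊆ Λ ∧ (∃ x ∈ X, x < p) ∧ ∃ x ∈ X, p ≤ x, Φ.qterm X := by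
    have hmem : ∀ X, X ∈ Λ.powerset \ (L ∪ L') ↔
        X ⊆ Λ ∧ (∃ x ∈ X, x < p) ∧ ∃ x ∈ X, p ≤ x := by
      intro X
      simp only [L, L', Finset.mem_sdiff, Finset.mem_union, Finset.mem_powerset, not_or,
        Finset.not_subset, Finset.mem_filter, not_and, not_lt, not_le]
      constructor
      · rintro ⟨h, ⟨u, hu, hu'⟩, v, hv, hv'⟩
        exact ⟨h, ⟨v, hv, hv' (h hv)⟩, u, hu, hu' (h hu)⟩
      · rintro ⟨h, ⟨u, hu, hu'⟩, v, hv, hv'⟩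
        exact ⟨h, ⟨v, hv, fun _ => hv'⟩, u, hu, fun _ => hu'⟩
    symm
    refine Finset.sum_subset (fun X hX => (hmem X).2 (Finset.mem_filter.1 hX).2) ?_
    intro X hX hX'
    by_contra hne
    have h := (hmem X).1 hX
    obtain ⟨-, ⟨u, hu, hu'⟩, v, hv, hv'⟩ := h
    refine hX' (Finset.mem_filter.2 ⟨Finset.mem_powerset.2 fun w hw => ?_, (hmem X).1 hX⟩)
    have h1 := Finset.mem_Icc.1 (hr.subset_Icc hne hu hw)
    have h2 := Finset.mem_Icc.1 (hr.subset_Icc hne hv hw)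
    rw [Finset.mem_Icc]
    omega
  rw [cut, ← hmain]
  change ∑ X ∈ Λ.powerset, Φ.qterm X - (∑ X ∈ L, Φ.qterm X + ∑ X ∈ L', Φ.qterm X) = _
  rw [← hu, ← hsd]
  abel

lemma cut_mem (hr : Φ.RangeLE R) (p : ℤ) (Λ : Finset ℤ) :
    Φ.cut p Λ ∈ Loc d (Finset.Icc (p - R) (p + R)) := by
  classical
  rw [cut_eq hr]
  refine Subalgebra.sub_mem _ (Subalgebra.sum_mem _ fun X hX => ?_) ?_
  · exact Loc_mono (Finset.mem_powerset.1 (Finset.mem_filter.1 hX).1) (Φ.qterm_mem X)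
  · exact Loc_mono (Finset.empty_subset _) (Φ.qterm_mem ∅)

lemma cut_congr (hr : Φ.RangeLE R) (p : ℤ) {Λ Λ' : Finset ℤ}
    (h : ∀ z, p - R ≤ z → z ≤ p + R → (z ∈ Λ ↔ z ∈ Λ')) : Φ.cut p Λ = Φ.cut p Λ' := by
  classical
  rw [cut_eq hr, cut_eq hr]
  congr 1
  refine Finset.sum_congr (Finset.filter_congr fun X hX => ?_) fun _ _ => rfl
  rw [Finset.mem_powerset] at hX
  refine and_congr_left fun _ => forall_congr' fun z => forall_congr' fun hz => ?_
  have := Finset.mem_Icc.1 (hX hz)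
  exact h z this.1 this.2

lemma norm_cut_le (hJ : 0 < J) (hr : Φ.RangeLE R) (hs : Φ.HasStrength J) (p : ℤ)
    (Λ : Finset ℤ) : ‖Φ.cut p Λ‖ ≤ 2 * siteStrength R J := by
  classical
  rw [cut_eq hr]
  refine (norm_sub_le _ _).trans ?_
  have h1 : ‖∑ X ∈ (Finset.Icc (p - R) (p + R)).powerset with
      X ⊆ Λ ∧ (∃ x ∈ X, x < p) ∧ ∃ x ∈ X, p ≤ x, Φ.qterm X‖ ≤ siteStrength R J := by
    refine (norm_sum_le _ _).trans
      ((Finset.sum_le_card_nsmul _ _ J fun X _ => hs.norm_qterm_le X).trans ?_)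
    rw [nsmul_eq_mul, siteStrength]
    refine mul_le_mul_of_nonneg_right ?_ hJ.le
    have := Finset.card_filter_le (Finset.Icc (p - (R : ℤ)) (p + R)).powerset
      (fun X => X ⊆ Λ ∧ (∃ x ∈ X, x < p) ∧ ∃ x ∈ X, p ≤ x)
    rw [card_powerset_Icc] at this
    exact_mod_cast this
  have h2 : ‖Φ.qterm ∅‖ ≤ siteStrength R J := by
    refine (hs.norm_qterm_le ∅).trans (le_mul_of_one_le_left hJ.le ?_)
    exact one_le_pow₀ one_le_two
  linarith

end Interaction
end SpinChain

end

/-! ### Expansionals of a Hamiltonian cut at one or two sites. -/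

noncomputable section

namespace BanachConj
open NormedSpace

section
variable {A : Type*} [NormedRing A] [NormedAlgebra ℂ A]

lemma conjExp_smul (z c : ℂ) (H Q : A) :
    conjExp z (c • H) (c • Q) = c • conjExp (z * c) H Q := by
  simp [conjExp, smul_smul]

/-- The value `c = -(1/2)` controls the inverse of a square-root expansional in
`norm_functional_ge`. -/
lemma norm_expansional_smul_le [CompleteSpace A] [NormOneClass A] {H H₀ : A} {M : ℝ} (c : ℂ) (hc : ‖c‖ ≤ 1)
    (h : ∀ z : ℂ, ‖z‖ ≤ 1 → ‖conjExp z H (H - H₀)‖ ≤ M) :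
    ‖exp (c • H) * exp (-(c • H₀))‖ ≤ Real.exp M := by
  have key := norm_expansional_le (H := c • H) (H₀ := c • H₀) (M := M) (fun s hs hs' => ?_)
    zero_le_one le_rfl
  · simpa using key
  · rw [← smul_sub, conjExp_smul, norm_smul]
    have hz : ‖(s : ℂ) * c‖ ≤ 1 := by
      rw [norm_mul, Complex.norm_real, Real.norm_of_nonneg hs]
      exact mul_le_one₀ hs' (norm_nonneg _) hc
    exact (mul_le_of_le_one_left (norm_nonneg _) hc).trans (h _ hz)

end

/-- A positive functional is bounded below on `S S*` if `S` has a bounded right inverse. -/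
lemma one_le_norm_sq_mul_of_mul_eq_one {A : Type*} [CStarAlgebra A] (ψ : A →L[ℂ] ℂ)
    (h1 : ψ 1 = 1) (hψ : ∀ a, 0 ≤ ψ (star a * a)) {S T : A} (h : S * T = 1) :
    1 ≤ ‖T‖ ^ 2 * ‖ψ (S * star S)‖ := by
  let _ : PartialOrder A := CStarAlgebra.spectralOrder A
  have _ : StarOrderedRing A := CStarAlgebra.spectralOrderedRing A
  -- Sandwiching `T T* ≤ ‖T‖²` between `S` and `S*` gives `1 ≤ ‖T‖² S S*`, because `S T = 1`.
  have hle : star (star T) * star T ≤ algebraMap ℝ A (‖star T‖ ^ 2) :=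
    CStarAlgebra.star_mul_le_algebraMap_norm_sq
  rw [← sub_nonneg, CStarAlgebra.nonneg_iff_eq_star_mul_self] at hle
  obtain ⟨y, hy⟩ := hle
  rw [star_star, norm_star] at hy
  have h' : star T * star S = 1 := by rw [← star_mul, h, star_one]
  have e : star (y * star S) * (y * star S) = ((‖T‖ ^ 2 : ℝ) : ℂ) • (S * star S) - 1 := by
    calc _ = S * (star y * y) * star S := by simp [mul_assoc]
      _ = S * algebraMap ℝ A (‖T‖ ^ 2) * star S - (S * T) * (star T * star S) := by
        rw [← hy]; noncomm_ring
      _ = _ := by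
        rw [h, h', one_mul, Algebra.algebraMap_eq_smul_one, mul_smul_comm, mul_one, smul_mul_assoc]
        rfl
  have hn := hψ (y * star S)
  rw [e, map_sub, map_smul, h1, smul_eq_mul, sub_nonneg] at hn
  have hre := (Complex.le_def.1 hn).1
  rw [Complex.one_re, Complex.re_ofReal_mul] at hre
  exact hre.trans (mul_le_mul_of_nonneg_left (Complex.re_le_norm _) (by positivity))

end BanachConj

namespace SpinChain
open NormedSpace BanachConj

/-- A bound on the time-evolved coupling terms at a site. -/
def cutBound (R : ℕ) (J : ℝ) : ℝ :=
  growthBound (2 * siteStrength R J * (2 * R + 1)) (4 * siteStrength R J * R) 1 *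
    (2 * siteStrength R J)

lemma cutBound_pos (R : ℕ) {J : ℝ} (hJ : 0 < J) : 0 < cutBound R J :=
  mul_pos (growthBound_pos _ _ _) (mul_pos two_pos (siteStrength_pos R hJ))

/-- The constant in the locality estimate of the expansionals, for the decay rate `l`. -/
def expansionalConst (R : ℕ) (J l : ℝ) : ℝ :=
  2 * growthBound (2 * siteStrength R J * (2 * R + 1)) (4 * siteStrength R J * R) (Real.exp l) *
    (2 * siteStrength R J) *
    (Real.exp (cutBound R J) * Real.exp (cutBound R J) / cutBound R J)

lemma expansionalConst_pos (R : ℕ) {J : ℝ} (hJ : 0 < J) (l : ℝ) :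
    0 < expansionalConst R J l := by
  have := cutBound_pos R hJ
  have := siteStrength_pos R hJ
  have := growthBound_pos (2 * siteStrength R J * (2 * R + 1)) (4 * siteStrength R J * R)
    (Real.exp l)
  unfold expansionalConst
  positivity

instance {d : ℕ} [NeZero d] : NormOneClass (QuasiLocalAlg d) where
  norm_one := by
    have : ‖embed d ∅ 1‖ = 1 := by rw [norm_embed, norm_one]
    rwa [map_one] at this

namespace Interaction
variable {d : ℕ} [NeZero d] {Φ : Interaction d} {R : ℕ} {J : ℝ}

lemma card_Icc_site (p : ℤ) (R : ℕ) :
    ((Finset.Icc (p - (R : ℤ)) (p + R)).card : ℝ) = 2 * R + 1 := by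
  have : (Finset.Icc (p - (R : ℤ)) (p + R)).card = 2 * R + 1 := by
    rw [Int.card_Icc]; omega
  rw [this]
  push_cast
  ring

variable (Φ) in
/-- Araki's expansional `e^{H_Λ} e^{-(H_L + H_R)}`, where `Λ` is cut at `p` into `L` and `R`. -/
def expansional (p : ℤ) (Λ : Finset ℤ) : QuasiLocalAlg d :=
  exp (Φ.qham Λ) * exp (-(Φ.qham (Λ.filter (· < p)) + Φ.qham (Λ.filter (p ≤ ·))))

lemma expansional_mem (p : ℤ) (Λ : Finset ℤ) : Φ.expansional p Λ ∈ Loc d Λ := by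
  refine Subalgebra.mul_mem _ (exp_mem_Loc (Φ.qham_mem Λ)) (exp_mem_Loc (Subalgebra.neg_mem _
    (Subalgebra.add_mem _ ?_ ?_)))
  · exact Loc_mono (Finset.filter_subset _ _) (Φ.qham_mem _)
  · exact Loc_mono (Finset.filter_subset _ _) (Φ.qham_mem _)

section bounds
variable (hJ : 0 < J) (hR : 1 ≤ R) (hr : Φ.RangeLE R) (hs : Φ.HasStrength J)
include hJ hR hr hs

lemma norm_conjExp_cut_le (p : ℤ) (Λ Λ' : Finset ℤ) (z : ℂ) (hz : ‖z‖ ≤ 1) :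
    ‖conjExp z (Φ.qham Λ') (Φ.cut p Λ)‖ ≤ cutBound R J := by
  have hG := siteStrength_pos R hJ
  refine (norm_conjExp_qham_le hJ hR hr hs Λ' (by omega) (cut_mem hr p Λ) z).trans ?_
  rw [card_Icc_site]
  exact mul_le_mul (growthBound_mono (by positivity) (by positivity) hz)
    (norm_cut_le hJ hr hs p Λ) (norm_nonneg _) (growthBound_pos _ _ _).le

lemma norm_expansional_le (p : ℤ) (Λ : Finset ℤ) :
    ‖Φ.expansional p Λ‖ ≤ Real.exp (cutBound R J) := by
  have := norm_expansional_smul_le (H := Φ.qham Λ) (M := cutBound R J) 1 (by simp)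
    (fun z hz => norm_conjExp_cut_le hJ hR hr hs p Λ Λ z hz)
  simpa [expansional] using this

/-- The window has radius `(N + 1) R`: `R` for the support of the cut and `N R` for `N` commutators.
A rate `l` above the growth rate of the evolution is needed in `tendsto_conjExp_expansional₂`. -/
lemma norm_expansional_sub_le (p : ℤ) {Λ Λ' : Finset ℤ} (N : ℕ)
    (h : ∀ z, p - ((N + 1) * R : ℕ) ≤ z → z ≤ p + ((N + 1) * R : ℕ) → (z ∈ Λ ↔ z ∈ Λ')) {l : ℝ}
    (hl : 0 ≤ l) :
    ‖Φ.expansional p Λ - Φ.expansional p Λ'‖ ≤ expansionalConst R J l * Real.exp (-(l * N)) := by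
  have hG := siteStrength_pos R hJ
  have e : (N + 1) * R = N * R + R := by ring
  rw [e] at h
  push_cast at h
  have hNR : (0 : ℤ) ≤ N * R := by positivity
  have hcut : Φ.cut p Λ = Φ.cut p Λ' :=
    cut_congr hr p fun z hz hz' => h z (by linarith) (by linarith)
  have key := BanachConj.norm_expansional_sub_le (H := Φ.qham Λ) (H' := Φ.qham Λ')
    (H₀ := Φ.qham (Λ.filter (· < p)) + Φ.qham (Λ.filter (p ≤ ·)))
    (H₀' := Φ.qham (Λ'.filter (· < p)) + Φ.qham (Λ'.filter (p ≤ ·)))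
    (cutBound_pos R hJ)
    (ε := 2 * Real.exp (-(l * N)) * growthBound (2 * siteStrength R J * (2 * R + 1))
      (4 * siteStrength R J * R) (Real.exp l) * (2 * siteStrength R J))
    (mul_nonneg (mul_nonneg (by positivity) (growthBound_pos _ _ _).le) (by positivity))
    (fun s h0 h1 => norm_conjExp_cut_le hJ hR hr hs p Λ Λ s
      (by rwa [Complex.norm_real, Real.norm_of_nonneg h0]))
    (fun s h0 h1 => norm_conjExp_cut_le hJ hR hr hs p Λ' Λ' s
      (by rwa [Complex.norm_real, Real.norm_of_nonneg h0]))
    (fun s h0 h1 => by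
      change ‖conjExp s (Φ.qham Λ) (Φ.cut p Λ) - conjExp s (Φ.qham Λ') (Φ.cut p Λ')‖ ≤ _
      rw [← hcut]
      refine (norm_conjExp_qham_sub_le hJ hR hr hs (by omega) (cut_mem hr p Λ) N
        (fun z hz hz' => h z (by push_cast at hz; linarith) (by push_cast at hz'; linarith))
        s hl).trans ?_
      rw [card_Icc_site]
      have : growthBound (2 * siteStrength R J * (2 * R + 1)) (4 * siteStrength R J * R)
          (‖(s : ℂ)‖ * Real.exp l) ≤ growthBound (2 * siteStrength R J * (2 * R + 1))
          (4 * siteStrength R J * R) (Real.exp l) := by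
        refine growthBound_mono (by positivity) (by positivity)
          (mul_le_of_le_one_left (Real.exp_pos _).le ?_)
        rwa [Complex.norm_real, Real.norm_of_nonneg h0]
      have hg := (growthBound_pos (2 * siteStrength R J * (2 * R + 1)) (4 * siteStrength R J * R)
          (Real.exp l)).le
      gcongr
      exact norm_cut_le hJ hr hs p Λ)
  refine key.trans (le_of_eq ?_)
  rw [expansionalConst]
  ring

end bounds

/-! ## Cutting out an interval -/

variable (Φ) in
/-- The Hamiltonian of `Λ` without the terms coupling `[a, e)` with its complement. -/
def decoupled (a e : ℤ) (Λ : Finset ℤ) : QuasiLocalAlg d :=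
  Φ.qham (Λ.filter (· < a)) +
    (Φ.qham ((Λ.filter (a ≤ ·)).filter (· < e)) + Φ.qham ((Λ.filter (a ≤ ·)).filter (e ≤ ·)))

variable (Φ) in
/-- The expansional `e^{H_Λ} e^{-H'}` with the decoupled Hamiltonian `H'`. -/
def expansional₂ (a e : ℤ) (Λ : Finset ℤ) : QuasiLocalAlg d :=
  exp (Φ.qham Λ) * exp (-Φ.decoupled a e Λ)

lemma decoupled_mem (a e : ℤ) (Λ : Finset ℤ) : Φ.decoupled a e Λ ∈ Loc d Λ := by
  refine Subalgebra.add_mem _ ?_ (Subalgebra.add_mem _ ?_ ?_)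
  · exact Loc_mono (Finset.filter_subset _ _) (Φ.qham_mem _)
  · exact Loc_mono ((Finset.filter_subset _ _).trans (Finset.filter_subset _ _)) (Φ.qham_mem _)
  · exact Loc_mono ((Finset.filter_subset _ _).trans (Finset.filter_subset _ _)) (Φ.qham_mem _)

lemma isSelfAdjoint_decoupled (a e : ℤ) (Λ : Finset ℤ) : IsSelfAdjoint (Φ.decoupled a e Λ) :=
  (Φ.isSelfAdjoint_qham _).add ((Φ.isSelfAdjoint_qham _).add (Φ.isSelfAdjoint_qham _))

lemma expansional₂_mem (a e : ℤ) (Λ : Finset ℤ) : Φ.expansional₂ a e Λ ∈ Loc d Λ :=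
  Subalgebra.mul_mem _ (exp_mem_Loc (Φ.qham_mem Λ))
    (exp_mem_Loc (Subalgebra.neg_mem _ (decoupled_mem a e Λ)))

/-- The Hamiltonian left of `a` commutes with everything to the right, so the exponentials of the
Hamiltonian on `[a, ∞) ∩ Λ` cancel between the two factors. One-cut estimates then suffice. -/
lemma expansional₂_eq (a e : ℤ) (Λ : Finset ℤ) :
    Φ.expansional₂ a e Λ = Φ.expansional a Λ * Φ.expansional e (Λ.filter (a ≤ ·)) := by
  have hd : Disjoint (Λ.filter (· < a)) (Λ.filter (a ≤ ·)) :=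
    Finset.disjoint_left.2 fun x hx hx' => by
      have := (Finset.mem_filter.1 hx).2
      have := (Finset.mem_filter.1 hx').2
      omega
  have c : ∀ {Q}, Q ∈ Loc d (Λ.filter (a ≤ ·)) → Commute (Φ.qham (Λ.filter (· < a))) Q :=
    fun hQ => commute_of_disjoint hd (Φ.qham_mem _) hQ
  rw [expansional₂, decoupled, expansional, expansional, neg_add, neg_add (Φ.qham (Λ.filter (· < a))),
    exp_add_of_commute' (c (Φ.qham_mem _)).neg_left.neg_right,
    exp_add_of_commute' (Commute.neg_right (c (Subalgebra.add_mem _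
      (Loc_mono (Finset.filter_subset _ _) (Φ.qham_mem _))
      (Loc_mono (Finset.filter_subset _ _) (Φ.qham_mem _)))).neg_left)]
  simp only [mul_assoc]
  rw [← mul_assoc (exp (-Φ.qham (Λ.filter (a ≤ ·)))), exp_neg_mul_exp, one_mul]

lemma qham_sub_decoupled (a e : ℤ) (Λ : Finset ℤ) :
    Φ.qham Λ - Φ.decoupled a e Λ = Φ.cut a Λ + Φ.cut e (Λ.filter (a ≤ ·)) := by
  simp only [cut, decoupled]
  abel

/-- Evolution by `-1/2` symmetrizes the expansional to `exp (H/2) exp (-D) exp (H/2) = S S*` with `S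
= exp (H/2) exp (-D/2)`. The inverse `T` of `S` is again controlled by an expansional; the two cuts
contribute one `cutBound` each. -/
lemma norm_functional_ge (hJ : 0 < J) (hR : 1 ≤ R) (hr : Φ.RangeLE R) (hs : Φ.HasStrength J)
    {ψ : QuasiLocalAlg d →L[ℂ] ℂ} (hψ : IsState ψ) (a e : ℤ) (Λ : Finset ℤ) :
    Real.exp (-(4 * cutBound R J)) ≤
      ‖ψ (conjExp (-(1 / 2)) (Φ.qham Λ) (Φ.expansional₂ a e Λ))‖ := by
  set H := Φ.qham Λ with hH
  set D := Φ.decoupled a e Λ with hD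
  have sH : star ((1 / 2 : ℂ) • H) = (1 / 2 : ℂ) • H := by
    rw [star_smul, hH, (Φ.isSelfAdjoint_qham Λ).star_eq]; simp
  have sD : star ((1 / 2 : ℂ) • D) = (1 / 2 : ℂ) • D := by
    rw [star_smul, hD, (isSelfAdjoint_decoupled a e Λ).star_eq]; simp
  have dD : exp (-D) = exp (-((1 / 2 : ℂ) • D)) * exp (-((1 / 2 : ℂ) • D)) := by
    rw [← smul_neg, ← exp_add_smul]; norm_num
  have dH : exp H = exp ((1 / 2 : ℂ) • H) * exp ((1 / 2 : ℂ) • H) := by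
    rw [← exp_add_smul]; norm_num
  have hbound := norm_expansional_smul_le (H := H) (H₀ := D) (M := 2 * cutBound R J) (-(1 / 2))
    (by norm_num) (fun z hz => by
      rw [hH, hD, qham_sub_decoupled, conjExp_add]
      refine (norm_add_le _ _).trans ?_
      have h1 := norm_conjExp_cut_le hJ hR hr hs a Λ Λ z hz
      have h2 := norm_conjExp_cut_le hJ hR hr hs e (Λ.filter (a ≤ ·)) Λ z hz
      linarith)
  set S := exp ((1 / 2 : ℂ) • H) * exp (-((1 / 2 : ℂ) • D)) with hS
  set T := exp ((1 / 2 : ℂ) • D) * exp (-((1 / 2 : ℂ) • H)) with hT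
  have hST : S * T = 1 := by
    calc S * T = exp ((1 / 2 : ℂ) • H) * (exp (-((1 / 2 : ℂ) • D)) * exp ((1 / 2 : ℂ) • D)) *
          exp (-((1 / 2 : ℂ) • H)) := by simp only [hS, hT, mul_assoc]
      _ = 1 := by rw [exp_neg_mul_exp, mul_one, exp_mul_exp_neg]
  have hTn : ‖T‖ ≤ Real.exp (2 * cutBound R J) := by
    rw [← norm_star, hT, star_mul, star_exp, star_exp, star_neg, sH, sD]
    simpa using hbound
  have hSS : conjExp (-(1 / 2)) H (Φ.expansional₂ a e Λ) = S * star S := by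
    rw [hS, star_mul, star_exp, star_exp, star_neg, sH, sD, conjExp, expansional₂, ← hH, ← hD, dH,
      dD, neg_smul, neg_neg]
    calc _ = (exp (-((1 / 2 : ℂ) • H)) * exp ((1 / 2 : ℂ) • H)) * (exp ((1 / 2 : ℂ) • H) *
          exp (-((1 / 2 : ℂ) • D)) * exp (-((1 / 2 : ℂ) • D)) * exp ((1 / 2 : ℂ) • H)) := by
          simp only [mul_assoc]
      _ = _ := by rw [exp_neg_mul_exp, one_mul]; simp only [mul_assoc]
  rw [hSS]
  have key := one_le_norm_sq_mul_of_mul_eq_one ψ hψ.map_one hψ.nonneg hST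
  have : ‖T‖ ^ 2 ≤ Real.exp (4 * cutBound R J) := by
    calc ‖T‖ ^ 2 ≤ Real.exp (2 * cutBound R J) ^ 2 := by gcongr
      _ = _ := by rw [← Real.exp_nat_mul]; congr 1; push_cast; ring
  rw [Real.exp_neg, inv_le_iff_one_le_mul₀ (Real.exp_pos _)]
  calc 1 ≤ ‖T‖ ^ 2 * ‖ψ (S * star S)‖ := key
    _ ≤ _ := by rw [mul_comm]; gcongr

end Interaction
end SpinChain

end

noncomputable section

/-! ## Complex analysis in a strip -/

/-- The three lines theorem with bound `0` on one side forces `D` to vanish inside the strip, and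
continuity carries this to the other side. -/
lemma eq_zero_on_upper_line_of_eq_zero_on_real {D : ℂ → ℂ}
    (hc : ContinuousOn D {z | 0 ≤ z.im ∧ z.im ≤ 1})
    (hd : DifferentiableOn ℂ D {z | 0 < z.im ∧ z.im < 1})
    (hb : ∃ C : ℝ, ∀ z : ℂ, 0 ≤ z.im → z.im ≤ 1 → ‖D z‖ ≤ C) (h0 : ∀ t : ℝ, D t = 0) (t : ℝ) :
    D (t + Complex.I) = 0 := by
  obtain ⟨C, hC⟩ := hb
  let f : ℂ → ℂ := fun w => D (t + Complex.I * w)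
  have him : ∀ w : ℂ, (t + Complex.I * w).im = w.re := fun w => by simp
  have hfc : ContinuousOn f (Complex.re ⁻¹' Set.Icc 0 1) := by
    refine hc.comp (by fun_prop) fun w hw => ?_
    simpa [him] using hw
  have hfd : DifferentiableOn ℂ f (Complex.re ⁻¹' Set.Ioo 0 1) := by
    refine hd.comp (by fun_prop) fun w hw => ?_
    simpa [him] using hw
  have hcl : closure (Complex.re ⁻¹' Set.Ioo (0 : ℝ) 1) ⊆ Complex.re ⁻¹' Set.Icc 0 1 :=
    closure_minimal (Set.preimage_mono Set.Ioo_subset_Icc_self)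
      (isClosed_Icc.preimage Complex.continuous_re)
  have hfz : ∀ x : ℝ, x ∈ Set.Ico (0 : ℝ) 1 → f x = 0 := by
    intro x hx
    have key := Complex.HadamardThreeLines.norm_le_interp_of_mem_verticalClosedStrip'
      (f := f) (z := (x : ℂ)) (a := 0) (b := C) (l := 0) (u := 1) one_pos
      (by simpa [Complex.HadamardThreeLines.verticalClosedStrip] using ⟨hx.1, hx.2.le⟩)
      ⟨hfd, hfc.mono hcl⟩
      ⟨C, by
        rintro _ ⟨w, hw, rfl⟩
        exact hC _ (by rw [him]; exact hw.1) (by rw [him]; exact hw.2)⟩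
      (fun w hw => by
        have hw : w.re = 0 := hw
        have e : (t : ℂ) + Complex.I * w = ((t - w.im : ℝ) : ℂ) := by
          apply Complex.ext <;> simp [hw]
          ring
        simp only [f, e, h0, norm_zero, le_refl])
      (fun w hw => by
        have hw : w.re = 1 := hw
        exact hC _ (by rw [him, hw]; exact zero_le_one) (by rw [him, hw]))
    -- The exponent of `0` is `1 - x`, which is why `x = 1` is left to continuity.
    have hne : (1 : ℝ) - ((x : ℂ).re - 0) / (1 - 0) ≠ 0 := by
      simp only [Complex.ofReal_re, sub_zero, div_one]
      linarith [hx.2]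
    rw [Real.zero_rpow hne, zero_mul] at key
    exact norm_le_zero_iff.1 key
  have hg : ContinuousOn (fun x : ℝ => f x) (Set.Icc 0 1) :=
    hfc.comp Complex.continuous_ofReal.continuousOn fun x hx => by simpa using hx
  have h1 : f (1 : ℝ) = 0 := by
    refine Set.EqOn.of_subset_closure (s := Set.Ico (0 : ℝ) 1) (f := fun x : ℝ => f x)
      (g := fun _ => 0) hfz hg continuousOn_const Set.Ico_subset_Icc_self ?_
      (Set.right_mem_Icc.2 zero_le_one)
    rw [closure_Ico zero_ne_one]
  simpa [f] using h1

/-- An entire function that is bounded on the strip `0 ≤ Im z ≤ 1` and takes the same boundary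
values on both sides is constant. -/
lemma eq_of_boundary_values_eq {G : ℂ → ℂ} (hG : Differentiable ℂ G)
    (hb : ∃ C : ℝ, ∀ z : ℂ, 0 ≤ z.im → z.im ≤ 1 → ‖G z‖ ≤ C)
    (h : ∀ t : ℝ, G (t + Complex.I) = G t) (z w : ℂ) : G z = G w := by
  obtain ⟨C, hC⟩ := hb
  -- The identity theorem at the points `1 / (n + 1)` accumulating at `0` gives the period `I`. The
  -- bound on the strip is then global and Liouville's theorem applies.
  have hper : Function.Periodic G Complex.I := by
    have hA : AnalyticOnNhd ℂ (fun z => G (z + Complex.I)) Set.univ :=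
      (hG.comp (differentiable_id.add_const _)).differentiableOn.analyticOnNhd isOpen_univ
    have hA' : AnalyticOnNhd ℂ G Set.univ := hG.differentiableOn.analyticOnNhd isOpen_univ
    have : (fun z => G (z + Complex.I)) = G := by
      refine AnalyticOnNhd.eq_of_frequently_eq (z₀ := 0) hA hA' ?_
      have ht : Tendsto (fun n : ℕ => (((1 / ((n : ℝ) + 1) : ℝ)) : ℂ)) atTop (𝓝[≠] 0) := by
        refine tendsto_nhdsWithin_iff.2 ⟨?_, Eventually.of_forall fun n => ?_⟩
        · have := (Complex.continuous_ofReal.tendsto 0).comp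
            (tendsto_one_div_add_atTop_nhds_zero_nat (𝕜 := ℝ))
          rwa [Complex.ofReal_zero] at this
        · have : (1 / ((n : ℝ) + 1) : ℝ) ≠ 0 := by positivity
          exact Complex.ofReal_ne_zero.2 this
      exact ht.frequently (Frequently.of_forall fun n => h _)
    exact fun z => congrFun this z
  refine hG.apply_eq_apply_of_bounded ?_ z w
  rw [isBounded_iff_forall_norm_le]
  refine ⟨C, ?_⟩
  rintro _ ⟨z, rfl⟩
  rw [← hper.sub_zsmul_eq ⌊z.im⌋]
  refine hC _ ?_ ?_
  · simp
  · simpa using (Int.fract_lt_one z.im).le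

namespace SpinChain
open NormedSpace BanachConj

namespace Interaction
variable {d : ℕ} [NeZero d] {Φ : Interaction d} {R : ℕ} {J : ℝ}

/-- The imaginary part of `z` contributes only unitaries. This gives bounds on the whole unbounded
strip. -/
lemma norm_conjExp_qham_eq_re_le (Λ : Finset ℤ) (z : ℂ) (Q : QuasiLocalAlg d) :
    ‖conjExp z (Φ.qham Λ) Q‖ ≤ ‖conjExp (z.re : ℂ) (Φ.qham Λ) Q‖ := by
  let _ : NormedAlgebra ℚ (QuasiLocalAlg d) := NormedAlgebra.restrictScalars ℚ ℂ _
  have : Nontrivial (QuasiLocalAlg d) := NormOneClass.nontrivial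
  have hu : ∀ t : ℝ, ‖exp (((t : ℂ) * Complex.I) • Φ.qham Λ)‖ = 1 := by
    intro t
    refine CStarRing.norm_of_mem_unitary (exp_mem_unitary_of_mem_skewAdjoint ?_)
    rw [skewAdjoint.mem_iff, star_smul, (Φ.isSelfAdjoint_qham Λ).star_eq]
    simp
  have hz : z = (z.im : ℂ) * Complex.I + z.re := by
    rw [add_comm]; exact (Complex.re_add_im z).symm
  conv_lhs => rw [hz, ← conjExp_conjExp]
  generalize conjExp (z.re : ℂ) (Φ.qham Λ) Q = P
  have h2 : exp (-(((z.im : ℂ) * Complex.I) • Φ.qham Λ)) =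
      exp ((((-z.im : ℝ) : ℂ) * Complex.I) • Φ.qham Λ) := by
    rw [← neg_smul]; simp
  calc _ ≤ ‖exp (((z.im : ℂ) * Complex.I) • Φ.qham Λ)‖ * ‖P‖ *
        ‖exp (-(((z.im : ℂ) * Complex.I) • Φ.qham Λ))‖ :=
        (norm_mul_le _ _).trans (mul_le_mul_of_nonneg_right (norm_mul_le _ _) (norm_nonneg _))
    _ = ‖P‖ := by rw [h2, hu, hu, one_mul, mul_one]

/-! ## The complex time evolution of local observables -/

variable (Φ) in
/-- The limit of `e^{zH_n} Q e^{-zH_n}` for the Hamiltonians of the intervals `[-n, n]`. -/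
def complexEvolution (z : ℂ) (Q : QuasiLocalAlg d) : QuasiLocalAlg d :=
  limUnder atTop fun n : ℕ => conjExp z (Φ.qham (Finset.Icc (-(n : ℤ)) n)) Q

lemma evolution_eq (t : ℝ) (Q : QuasiLocalAlg d) :
    Φ.evolution t Q = Φ.complexEvolution (Complex.I * t) Q := by
  unfold evolution complexEvolution regionEvolution conjExp
  congr 1
  funext n
  rw [embed_exp, embed_exp, map_smul, map_smul, embed_hamiltonian, neg_smul]

section bounds
variable (hJ : 0 < J) (hR : 1 ≤ R) (hr : Φ.RangeLE R) (hs : Φ.HasStrength J)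
include hJ hR hr hs

lemma tendsto_conjExp_and_differentiable {x y : ℤ} (hxy : x ≤ y) {Q : QuasiLocalAlg d}
    (hQ : Q ∈ Loc d (Finset.Icc x y)) :
    (∀ z, Tendsto (fun n : ℕ => conjExp z (Φ.qham (Finset.Icc (-(n : ℤ)) n)) Q) atTop
      (𝓝 (Φ.complexEvolution z Q))) ∧ Differentiable ℂ fun z => Φ.complexEvolution z Q := by
  have hG := siteStrength_pos R hJ
  -- Infinite-volume coefficients: the `j`-th commutator sees only the `j R`-neighbourhood, so for
  -- each `j` the coefficient of the box `[-n, n]` equals `c j` once `n` is large. Dominated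
  -- convergence does the rest.
  let c : ℕ → QuasiLocalAlg d := fun j =>
    (adL (Φ.qham (Finset.Icc (x - (j * R : ℕ)) (y + (j * R : ℕ)))) ^ j) Q
  let F : ℂ → QuasiLocalAlg d := fun z => ∑' j : ℕ, (z ^ j / j.factorial : ℂ) • c j
  let u : ℝ → ℕ → ℝ := fun ρ j =>
    growthCoeff (2 * siteStrength R J * (Finset.Icc x y).card) (4 * siteStrength R J * R) j 0 *
      (ρ ^ j / j.factorial) * ‖Q‖
  have hu : ∀ ρ, 0 ≤ ρ → Summable (u ρ) := fun ρ hρ =>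
    (summable_growthCoeff (by positivity) (by positivity) 0 hρ).mul_right _
  have htend : ∀ z, Tendsto (fun n : ℕ => conjExp z (Φ.qham (Finset.Icc (-(n : ℤ)) n)) Q) atTop
      (𝓝 (F z)) := by
    intro z
    simp_rw [← (hasSum_conjExp z _ Q).tsum_eq]
    refine tendsto_tsum_of_dominated_convergence (hu ‖z‖ (norm_nonneg z)) (fun j => ?_)
      (Eventually.of_forall fun n j => norm_term_le hJ hR hr hs _ hxy hQ z j)
    refine tendsto_const_nhds.congr' ?_
    filter_upwards [eventually_ge_atTop (x.natAbs + y.natAbs + j * R)] with n hn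
    congr 1
    refine adL_pow_qham_eq hJ hr hs j hQ fun w hw hw' => ?_
    rw [Finset.mem_Icc, Finset.mem_Icc]
    omega
  have hF : ∀ z, Φ.complexEvolution z Q = F z := fun z => (htend z).limUnder_eq
  refine ⟨fun z => (hF z).symm ▸ htend z, ?_⟩
  rw [funext hF]
  intro z
  have hd : DifferentiableOn ℂ F (Metric.ball 0 (‖z‖ + 1)) := by
    refine Complex.differentiableOn_tsum_of_summable_norm (hu (‖z‖ + 1) (by positivity))
      (fun j => by fun_prop) Metric.isOpen_ball fun j w hw => ?_
    refine (norm_term_le hJ hR hr hs _ hxy hQ w j).trans ?_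
    have hw' : ‖w‖ ≤ ‖z‖ + 1 := (mem_ball_zero_iff.1 hw).le
    have := growthCoeff_nonneg (a := 2 * siteStrength R J * (Finset.Icc x y).card)
      (μ := 4 * siteStrength R J * R) (by positivity) (by positivity) j 0
    simp only [u]
    gcongr
  exact hd.differentiableAt (Metric.isOpen_ball.mem_nhds (by simp))

lemma tendsto_conjExp {x y : ℤ} (hxy : x ≤ y) {Q : QuasiLocalAlg d}
    (hQ : Q ∈ Loc d (Finset.Icc x y)) (z : ℂ) :
    Tendsto (fun n : ℕ => conjExp z (Φ.qham (Finset.Icc (-(n : ℤ)) n)) Q) atTop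
      (𝓝 (Φ.complexEvolution z Q)) :=
  (tendsto_conjExp_and_differentiable hJ hR hr hs hxy hQ).1 z

lemma norm_complexEvolution_le {x y : ℤ} (hxy : x ≤ y) {Q : QuasiLocalAlg d}
    (hQ : Q ∈ Loc d (Finset.Icc x y)) (z : ℂ) (hz : |z.re| ≤ 1) :
    ‖Φ.complexEvolution z Q‖ ≤ growthBound (2 * siteStrength R J * (Finset.Icc x y).card)
      (4 * siteStrength R J * R) 1 * ‖Q‖ := by
  have hG := siteStrength_pos R hJ
  refine le_of_tendsto (tendsto_conjExp hJ hR hr hs hxy hQ z).norm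
    (Eventually.of_forall fun n => ?_)
  refine (norm_conjExp_qham_eq_re_le _ z Q).trans
    ((norm_conjExp_qham_le hJ hR hr hs _ hxy hQ _).trans ?_)
  refine mul_le_mul_of_nonneg_right (growthBound_mono (by positivity) (by positivity) ?_)
    (norm_nonneg _)
  rwa [Complex.norm_real]

lemma complexEvolution_zero {x y : ℤ} (hxy : x ≤ y) {Q : QuasiLocalAlg d}
    (hQ : Q ∈ Loc d (Finset.Icc x y)) : Φ.complexEvolution 0 Q = Q := by
  refine tendsto_nhds_unique (tendsto_conjExp hJ hR hr hs hxy hQ 0) ?_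
  simp [conjExp]

lemma complexEvolution_add {x y : ℤ} (hxy : x ≤ y) {P Q : QuasiLocalAlg d}
    (hP : P ∈ Loc d (Finset.Icc x y)) (hQ : Q ∈ Loc d (Finset.Icc x y)) (z : ℂ) :
    Φ.complexEvolution z (P + Q) = Φ.complexEvolution z P + Φ.complexEvolution z Q := by
  refine tendsto_nhds_unique
    (tendsto_conjExp hJ hR hr hs hxy (Subalgebra.add_mem _ hP hQ) z) ?_
  simp_rw [conjExp_add]
  exact (tendsto_conjExp hJ hR hr hs hxy hP z).add (tendsto_conjExp hJ hR hr hs hxy hQ z)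

/-! ## The KMS condition for local observables -/

/-- The KMS condition provides only some function on the strip. It agrees on the real line with the
explicit entire function `z ↦ ψ (a * Φ.complexEvolution (I z) Q)`, hence also on the upper line. -/
lemma kms_boundary {ψ : QuasiLocalAlg d →L[ℂ] ℂ} (hψ : IsKMSState Φ ψ) {x y : ℤ} (hxy : x ≤ y)
    {Q : QuasiLocalAlg d} (hQ : Q ∈ Loc d (Finset.Icc x y)) (a : QuasiLocalAlg d) :
    Differentiable ℂ (fun z : ℂ => ψ (a * Φ.complexEvolution (Complex.I * z) Q)) ∧
    (∃ C : ℝ, ∀ z : ℂ, 0 ≤ z.im → z.im ≤ 1 →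
      ‖ψ (a * Φ.complexEvolution (Complex.I * z) Q)‖ ≤ C) ∧
    ∀ t : ℝ, ψ (a * Φ.complexEvolution (Complex.I * (t + Complex.I)) Q) =
      ψ (Φ.complexEvolution (Complex.I * t) Q * a) := by
  have hG := siteStrength_pos R hJ
  have hd : Differentiable ℂ (fun z : ℂ => ψ (a * Φ.complexEvolution (Complex.I * z) Q)) := by
    have h1 : Differentiable ℂ fun z : ℂ => Φ.complexEvolution (Complex.I * z) Q :=
      (tendsto_conjExp_and_differentiable hJ hR hr hs hxy hQ).2.comp
        (differentiable_id.const_mul Complex.I)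
    exact ψ.differentiable.comp (h1.const_mul a)
  have hb : ∃ C : ℝ, ∀ z : ℂ, 0 ≤ z.im → z.im ≤ 1 →
      ‖ψ (a * Φ.complexEvolution (Complex.I * z) Q)‖ ≤ C := by
    refine ⟨‖ψ‖ * (‖a‖ * (growthBound (2 * siteStrength R J * (Finset.Icc x y).card)
      (4 * siteStrength R J * R) 1 * ‖Q‖)), fun z h0 h1 => ?_⟩
    refine (ψ.le_opNorm _).trans (mul_le_mul_of_nonneg_left ((norm_mul_le _ _).trans
      (mul_le_mul_of_nonneg_left ?_ (norm_nonneg _))) (norm_nonneg _))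
    refine norm_complexEvolution_le hJ hR hr hs hxy hQ _ ?_
    simpa [abs_of_nonneg h0] using h1
  refine ⟨hd, hb, fun t => ?_⟩
  obtain ⟨F, hFc, hFd, ⟨C, hC⟩, hF0, hF1⟩ := hψ.kms a Q
  obtain ⟨C', hC'⟩ := hb
  have key := eq_zero_on_upper_line_of_eq_zero_on_real
    (D := fun z => F z - ψ (a * Φ.complexEvolution (Complex.I * z) Q))
    (hFc.sub hd.continuous.continuousOn) (hFd.sub hd.differentiableOn)
    ⟨C + C', fun z h0 h1 => (norm_sub_le _ _).trans (add_le_add (hC z h0 h1) (hC' z h0 h1))⟩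
    (fun t => by rw [hF0, evolution_eq, sub_self]) t
  rw [hF1, evolution_eq, sub_eq_zero] at key
  exact key.symm

lemma kms_local {ψ : QuasiLocalAlg d →L[ℂ] ℂ} (hψ : IsKMSState Φ ψ) {x y : ℤ} (hxy : x ≤ y)
    {Q : QuasiLocalAlg d} (hQ : Q ∈ Loc d (Finset.Icc x y)) (a : QuasiLocalAlg d) :
    ψ (Q * a) = ψ (a * Φ.complexEvolution (-1) Q) := by
  have := (kms_boundary hJ hR hr hs hψ hxy hQ a).2.2 0
  rw [Complex.ofReal_zero, zero_add, mul_zero, complexEvolution_zero hJ hR hr hs hxy hQ,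
    Complex.I_mul_I] at this
  exact this.symm

/-- For `a = 1` the two boundary values coincide, so `eq_of_boundary_values_eq` applies. -/
lemma kms_invariant {ψ : QuasiLocalAlg d →L[ℂ] ℂ} (hψ : IsKMSState Φ ψ) {x y : ℤ}
    (hxy : x ≤ y) {Q : QuasiLocalAlg d} (hQ : Q ∈ Loc d (Finset.Icc x y)) (z : ℂ) :
    ψ (Φ.complexEvolution z Q) = ψ Q := by
  obtain ⟨hd, hb, h⟩ := kms_boundary hJ hR hr hs hψ hxy hQ 1
  simp only [one_mul, mul_one] at hd hb h
  have := eq_of_boundary_values_eq hd hb h (-Complex.I * z) 0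
  rwa [mul_zero, complexEvolution_zero hJ hR hr hs hxy hQ, ← mul_assoc, mul_neg, Complex.I_mul_I,
    neg_neg, one_mul] at this

/-! ## Evolution of rapidly converging sequences -/

/-- `X k` may fill its whole box, so locality says nothing about it directly. After telescoping,
each increment is a fixed local observable, for which the difference tends to `0`. Evolution
multiplies the norm of the `j`-th increment by at most a constant times `exp (4 G R j)`, `G =
siteStrength R J`; the assumed decay beats this by `exp (-j)`, so dominated convergence in `j`
applies. -/
lemma tendsto_conjExp_sub_complexEvolution {n₀ : ℕ} {X : ℕ → QuasiLocalAlg d} {C : ℝ}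
    (hX : ∀ k, X k ∈ Loc d (Finset.Icc (-((n₀ + k * R : ℕ) : ℤ)) ((n₀ + k * R : ℕ) : ℤ)))
    (hC : ∀ k : ℕ, ‖X (k + 1) - X k‖ ≤ C * Real.exp (-((4 * siteStrength R J * R + 1) * k)))
    (z : ℂ) (hz : ‖z‖ ≤ 1) :
    Tendsto (fun k : ℕ => conjExp z
      (Φ.qham (Finset.Icc (-((n₀ + k * R : ℕ) : ℤ)) ((n₀ + k * R : ℕ) : ℤ))) (X k) -
        Φ.complexEvolution z (X k)) atTop (𝓝 0) := by
  have hG := siteStrength_pos R hJ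
  have hmono : ∀ {j k : ℕ}, j ≤ k →
      Loc d (Finset.Icc (-((n₀ + j * R : ℕ) : ℤ)) ((n₀ + j * R : ℕ) : ℤ)) ≤
      Loc d (Finset.Icc (-((n₀ + k * R : ℕ) : ℤ)) ((n₀ + k * R : ℕ) : ℤ)) := by
    intro j k hjk
    have h1 : j * R ≤ k * R := Nat.mul_le_mul_right R hjk
    exact Loc_mono (Finset.Icc_subset_Icc (by omega) (by omega))
  set H : ℕ → QuasiLocalAlg d := fun k =>
    Φ.qham (Finset.Icc (-((n₀ + k * R : ℕ) : ℤ)) ((n₀ + k * R : ℕ) : ℤ)) with hH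
  have hlim : ∀ {m : ℕ} {Q : QuasiLocalAlg d},
      Q ∈ Loc d (Finset.Icc (-((n₀ + m * R : ℕ) : ℤ)) ((n₀ + m * R : ℕ) : ℤ)) →
      Tendsto (fun k => conjExp z (H k) Q - Φ.complexEvolution z Q) atTop (𝓝 0) := by
    intro m Q hQ
    have h1 : Tendsto (fun k : ℕ => n₀ + k * R) atTop atTop :=
      tendsto_atTop_mono (fun k => (Nat.le_mul_of_pos_right k hR).trans (Nat.le_add_left _ _))
        tendsto_id
    have h2 := (tendsto_conjExp hJ hR hr hs (by omega) hQ z).comp h1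
    exact tendsto_sub_nhds_zero_iff.2 h2
  have hdmem : ∀ k, X (k + 1) - X k ∈
      Loc d (Finset.Icc (-((n₀ + (k + 1) * R : ℕ) : ℤ)) ((n₀ + (k + 1) * R : ℕ) : ℤ)) :=
    fun k => Subalgebra.sub_mem _ (hX (k + 1)) (hmono (Nat.le_succ k) (hX k))
  have hsum : ∀ k m, conjExp z (H m) (X k) - Φ.complexEvolution z (X k) =
      (conjExp z (H m) (X 0) - Φ.complexEvolution z (X 0)) +
      ∑ j ∈ Finset.range k, (conjExp z (H m) (X (j + 1) - X j) -
        Φ.complexEvolution z (X (j + 1) - X j)) := by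
    intro k m
    induction k with
    | zero => simp
    | succ k ih =>
      have e : X (k + 1) = X k + (X (k + 1) - X k) := by abel
      rw [Finset.sum_range_succ, ← add_assoc, ← ih]
      conv_lhs => rw [e, conjExp_add, complexEvolution_add hJ hR hr hs (by omega)
        (hmono (Nat.le_succ k) (hX k)) (hdmem k)]
      abel
  let f : ℕ → ℕ → QuasiLocalAlg d := fun k j => if j < k then
    conjExp z (H k) (X (j + 1) - X j) - Φ.complexEvolution z (X (j + 1) - X j) else 0
  have hf : ∀ k, ∑ j ∈ Finset.range k, (conjExp z (H k) (X (j + 1) - X j) -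
      Φ.complexEvolution z (X (j + 1) - X j)) = ∑' j, f k j := by
    intro k
    rw [tsum_eq_sum (s := Finset.range k) fun j hj => ?_]
    · exact Finset.sum_congr rfl fun j hj => by simp [f, Finset.mem_range.1 hj]
    · simp only [f]
      rw [if_neg (by simpa using hj)]
  have hmain : ∀ k, conjExp z (H k) (X k) - Φ.complexEvolution z (X k) =
      (conjExp z (H k) (X 0) - Φ.complexEvolution z (X 0)) + ∑' j, f k j :=
    fun k => by rw [hsum, hf]
  rw [funext hmain]
  have hgrow : ∀ j : ℕ, growthBound (2 * siteStrength R J *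
      (Finset.Icc (-((n₀ + (j + 1) * R : ℕ) : ℤ)) ((n₀ + (j + 1) * R : ℕ) : ℤ)).card)
      (4 * siteStrength R J * R) 1 =
      growthBound (2 * siteStrength R J * (2 * n₀ + 2 * R + 1)) (4 * siteStrength R J * R) 1 *
        Real.exp (4 * siteStrength R J * R * j) := by
    intro j
    have hc : (Finset.Icc (-((n₀ + (j + 1) * R : ℕ) : ℤ)) ((n₀ + (j + 1) * R : ℕ) : ℤ)).card =
        2 * (n₀ + (j + 1) * R) + 1 := by
      rw [Int.card_Icc]; omega
    rw [hc, growthBound, growthBound, ← Real.exp_add]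
    congr 1
    push_cast
    ring
  set K := growthBound (2 * siteStrength R J * (2 * n₀ + 2 * R + 1)) (4 * siteStrength R J * R) 1
  have hK : 0 < K := growthBound_pos _ _ _
  have hsummable : Summable fun j : ℕ => 2 * K * C * Real.exp (-(j : ℝ)) := by
    have := (Real.summable_exp_neg_nat).mul_left (2 * K * C)
    exact this
  have htan := tendsto_tsum_of_dominated_convergence (𝓕 := atTop) (f := f) (g := fun _ => 0)
    hsummable (fun j => (hlim (hdmem j)).congr' (by
      filter_upwards [eventually_gt_atTop j] with k hk
      exact (if_pos hk).symm)) (Eventually.of_forall fun k j => by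
      have hC0 : 0 ≤ C := by
        have := (norm_nonneg _).trans (hC 0)
        simpa using this
      simp only [f]
      split_ifs
      · have hre : |z.re| ≤ 1 := (Complex.abs_re_le_norm z).trans hz
        have n1 := norm_complexEvolution_le hJ hR hr hs (by omega) (hdmem j) z hre
        have n2' := norm_conjExp_qham_le hJ hR hr hs
          (Finset.Icc (-((n₀ + k * R : ℕ) : ℤ)) ((n₀ + k * R : ℕ) : ℤ)) (by omega) (hdmem j) z
        have n2 := n2'.trans (mul_le_mul_of_nonneg_right
            (growthBound_mono (mul_nonneg (by positivity) (Nat.cast_nonneg _)) (by positivity) hz)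
            (norm_nonneg _))
        rw [hgrow] at n1 n2
        calc _ ≤ K * Real.exp (4 * siteStrength R J * R * j) * ‖X (j + 1) - X j‖ +
              K * Real.exp (4 * siteStrength R J * R * j) * ‖X (j + 1) - X j‖ :=
              (norm_sub_le _ _).trans (add_le_add n2 n1)
          _ = 2 * (K * Real.exp (4 * siteStrength R J * R * j)) * ‖X (j + 1) - X j‖ := by ring
          _ ≤ 2 * (K * Real.exp (4 * siteStrength R J * R * j)) *
              (C * Real.exp (-((4 * siteStrength R J * R + 1) * j))) := by
              gcongr
              exact hC j
          _ = 2 * K * C * (Real.exp (4 * siteStrength R J * R * j) *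
              Real.exp (-((4 * siteStrength R J * R + 1) * j))) := by ring
          _ = _ := by
              rw [← Real.exp_add]
              congr 2
              ring
      · rw [norm_zero]
        positivity)
  rw [tsum_zero] at htan
  simpa using (hlim (hX 0)).add htan

end bounds
end Interaction
end SpinChain

end

/-! ### From the KMS state of the chain to the Gibbs state of an interval. -/

noncomputable section

lemma Matrix.linearMap_eq_smul_trace_of_mul_comm {n : Type*} [Fintype n] [Nonempty n]
    (f : Matrix n n ℂ →ₗ[ℂ] ℂ) (hf : ∀ M N, f (M * N) = f (N * M)) :
    ∃ c : ℂ, ∀ M, f M = c * M.trace := by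
  classical
  obtain ⟨i₀⟩ := ‹Nonempty n›
  refine ⟨f (Matrix.single i₀ i₀ 1), fun M => ?_⟩
  have key : ∀ i j, f (Matrix.single i j (M i j)) =
      if i = j then f (Matrix.single i₀ i₀ 1) * M i i else 0 := by
    intro i j
    split_ifs with h
    · subst h
      have h1 : Matrix.single i i (M i i) =
          Matrix.single i i₀ (M i i) * Matrix.single i₀ i (1 : ℂ) := by simp
      have h2 : Matrix.single i₀ i (1 : ℂ) * Matrix.single i i₀ (M i i) =
          M i i • Matrix.single i₀ i₀ (1 : ℂ) := by simp
      rw [h1, hf, h2, map_smul, smul_eq_mul, mul_comm]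
    · have h1 : Matrix.single i j (M i j) =
          Matrix.single i i (1 : ℂ) * Matrix.single i j (M i j) := by simp
      rw [h1, hf, Matrix.single_mul_single_of_ne (h := Ne.symm h), map_zero]
  conv_lhs => rw [Matrix.matrix_eq_sum_single M]
  simp [map_sum, key, Matrix.trace, Finset.mul_sum]

/-- A normalized positive functional on a C*-algebra is contractive. -/
lemma norm_apply_le_of_positive {A : Type*} [CStarAlgebra A] [NormOneClass A] (ψ : A →L[ℂ] ℂ)
    (h1 : ψ 1 = 1) (hψ : ∀ a, 0 ≤ ψ (star a * a)) (a : A) : ‖ψ a‖ ≤ ‖a‖ := by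
  have hsa : ∀ b : A, IsSelfAdjoint b → (ψ b).im = 0 ∧ (ψ b).re ≤ ‖b‖ := by
    intro b hb
    let _ : PartialOrder A := CStarAlgebra.spectralOrder A
    have _ : StarOrderedRing A := CStarAlgebra.spectralOrderedRing A
    have hle := hb.le_algebraMap_norm_self
    rw [← sub_nonneg, CStarAlgebra.nonneg_iff_eq_star_mul_self] at hle
    obtain ⟨y, hy⟩ := hle
    have e : star y * y = ((‖b‖ : ℝ) : ℂ) • (1 : A) - b := by
      rw [← hy, Algebra.algebraMap_eq_smul_one]; rfl
    have hn := hψ y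
    rw [e, map_sub, map_smul, h1, smul_eq_mul, mul_one, Complex.le_def] at hn
    obtain ⟨h1, h2⟩ := hn
    simp at h1 h2
    exact ⟨h2, h1⟩
  -- A phase makes `ψ (u a)` real and equal to `|ψ a|`, so only the real part of `u a` matters and
  -- the self-adjoint case suffices.
  obtain ⟨u, hu, hu'⟩ : ∃ u : ℂ, ‖u‖ = 1 ∧ u * ψ a = ‖ψ a‖ := by
    by_cases h0 : ψ a = 0
    · exact ⟨1, by simp, by simp [h0]⟩
    · have hn : (‖ψ a‖ : ℂ) ≠ 0 := by simpa using h0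
      refine ⟨star (ψ a) / ‖ψ a‖, ?_, ?_⟩
      · rw [norm_div, norm_star, Complex.norm_real, norm_norm, div_self (by simpa using h0)]
      · rw [div_mul_eq_mul_div, div_eq_iff hn, mul_comm, ← sq]
        exact Complex.mul_conj' (ψ a)
  have hre := hsa _ (realPart (u • a)).2
  have him := hsa _ (imaginaryPart (u • a)).2
  have e : (‖ψ a‖ : ℂ) = ψ (realPart (u • a)) + Complex.I * ψ (imaginaryPart (u • a)) := by
    rw [← hu', ← smul_eq_mul, ← map_smul, ← smul_eq_mul, ← map_smul, ← map_add,
      realPart_add_I_smul_imaginaryPart]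
  have := congrArg Complex.re e
  simp only [Complex.ofReal_re, Complex.add_re, Complex.mul_re, Complex.I_re, zero_mul,
    Complex.I_im, one_mul, him.1, sub_zero, add_zero] at this
  rw [this]
  refine hre.2.trans ((realPart.norm_le (u • a)).trans ?_)
  rw [norm_smul, hu, one_mul]

namespace SpinChain
open NormedSpace BanachConj

lemma IsState.norm_apply_le {d : ℕ} [NeZero d] {ψ : QuasiLocalAlg d →L[ℂ] ℂ} (h : IsState ψ)
    (a : QuasiLocalAlg d) : ‖ψ a‖ ≤ ‖a‖ :=
  norm_apply_le_of_positive ψ h.map_one h.nonneg a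

namespace Interaction
variable {d : ℕ} [NeZero d] {Φ : Interaction d} {R : ℕ} {J : ℝ}

/-- An interval exhausting `ℤ` along a sequence adapted to the range `R` and the interval
`[a, e)`. -/
def box (R : ℕ) (a e : ℤ) (k : ℕ) : Finset ℤ :=
  Finset.Icc (-((a.natAbs + e.natAbs + R + k * R : ℕ) : ℤ))
    ((a.natAbs + e.natAbs + R + k * R : ℕ) : ℤ)

lemma mem_box {R : ℕ} {a e : ℤ} {k : ℕ} {z : ℤ} :
    z ∈ box R a e k ↔ z.natAbs ≤ a.natAbs + e.natAbs + (k + 1) * R := by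
  have : (k + 1) * R = R + k * R := by ring
  rw [box, Finset.mem_Icc, this]
  omega

lemma mem_box_of_le {R : ℕ} {a e : ℤ} {k N : ℕ} (h : N ≤ k) {p : ℤ}
    (hp : p.natAbs ≤ a.natAbs + e.natAbs) {z : ℤ} (h1 : p - ((N + 1) * R : ℕ) ≤ z)
    (h2 : z ≤ p + ((N + 1) * R : ℕ)) : z ∈ box R a e k := by
  rw [mem_box]
  have : (N + 1) * R ≤ (k + 1) * R := Nat.mul_le_mul_right R (by omega)
  omega

lemma Ico_subset_box (R : ℕ) (a e : ℤ) (k : ℕ) : Finset.Ico a e ⊆ box R a e k := by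
  intro z hz
  rw [Finset.mem_Ico] at hz
  rw [mem_box]
  omega

lemma filter_box (R : ℕ) (a e : ℤ) (k : ℕ) :
    ((box R a e k).filter (a ≤ ·)).filter (· < e) = Finset.Ico a e := by
  ext z
  simp only [Finset.mem_filter, Finset.mem_Ico]
  constructor
  · rintro ⟨⟨-, h⟩, h'⟩
    exact ⟨h, h'⟩
  · intro h
    exact ⟨⟨Ico_subset_box R a e k (Finset.mem_Ico.2 h), h.1⟩, h.2⟩

/-- The left side is `exp (-h) exp (-B) p exp H`, where `B` lives outside `[a, e)` and commutes with
`p`. Pulling `p` to the left costs only a conjugation with the Hamiltonian `h` of the interval. -/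
lemma expansional₂_conj (R : ℕ) (a e : ℤ) (k : ℕ) {p : QuasiLocalAlg d}
    (hp : p ∈ Loc d (Finset.Ico a e)) :
    conjExp (-1) (Φ.qham (box R a e k)) (Φ.expansional₂ a e (box R a e k) * p) =
      exp (-Φ.qham (Finset.Ico a e)) * p * exp (Φ.qham (Finset.Ico a e)) *
        conjExp (-1) (Φ.qham (box R a e k)) (Φ.expansional₂ a e (box R a e k)) := by
  set Λ := box R a e k
  set H := Φ.qham Λ
  set h := Φ.qham (Finset.Ico a e) with hh
  set B := Φ.qham (Λ.filter (· < a)) + Φ.qham ((Λ.filter (a ≤ ·)).filter (e ≤ ·)) with hB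
  have hD : Φ.decoupled a e Λ = h + B := by
    rw [decoupled, filter_box]
    simp only [hh, hB]
    abel
  have hcomm : ∀ {q}, q ∈ Loc d (Finset.Ico a e) → Commute q B := by
    intro q hq
    refine Commute.add_right (commute_of_disjoint ?_ hq (Φ.qham_mem _))
      (commute_of_disjoint ?_ hq (Φ.qham_mem _))
    · refine Finset.disjoint_left.2 fun x hx hx' => ?_
      have := (Finset.mem_filter.1 hx').2
      have := Finset.mem_Ico.1 hx
      omega
    · refine Finset.disjoint_left.2 fun x hx hx' => ?_
      have := (Finset.mem_filter.1 hx').2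
      have := Finset.mem_Ico.1 hx
      omega
  have hexp : exp (-Φ.decoupled a e Λ) = exp (-h) * exp (-B) := by
    rw [hD, neg_add, exp_add_of_commute' (hcomm (Φ.qham_mem _)).neg_left.neg_right]
  have hpB : exp (-B) * p = p * exp (-B) := by
    let _ : NormedAlgebra ℚ (QuasiLocalAlg d) := NormedAlgebra.restrictScalars ℚ ℂ _
    exact ((hcomm hp).neg_right.exp_right).eq.symm
  simp only [conjExp, expansional₂, neg_smul, one_smul, neg_neg, hexp]
  calc _ = (exp (-H) * exp H) * exp (-h) * (exp (-B) * p) * exp H := by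
        simp only [H, mul_assoc]
    _ = exp (-h) * p * exp (-B) * exp H := by
        rw [exp_neg_mul_exp, hpB, one_mul]; simp only [mul_assoc]
    _ = exp (-h) * p * (exp h * exp (-h)) * exp (-B) * exp H := by
        rw [exp_mul_exp_neg, mul_one]
    _ = exp (-h) * p * exp h * ((exp (-H) * exp H) * exp (-h) * exp (-B) * exp H) := by
        rw [exp_neg_mul_exp]; simp only [one_mul, mul_assoc]
    _ = _ := by simp only [H, mul_assoc]

section bounds
variable (hJ : 0 < J) (hR : 1 ≤ R) (hr : Φ.RangeLE R) (hs : Φ.HasStrength J)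
include hJ hR hr hs

lemma norm_mul_expansional_le (p q : ℤ) (Λ Λ' : Finset ℤ) :
    ‖Φ.expansional p Λ * Φ.expansional q Λ'‖ ≤ Real.exp (2 * cutBound R J) := by
  rw [two_mul, Real.exp_add]
  exact (norm_mul_le _ _).trans (mul_le_mul (norm_expansional_le hJ hR hr hs _ _)
    (norm_expansional_le hJ hR hr hs _ _) (norm_nonneg _) (Real.exp_pos _).le)

lemma norm_mul_expansional_sub_le (p q : ℤ) {Λ₁ Λ₂ Λ₁' Λ₂' : Finset ℤ} (N : ℕ)
    (h₁ : ∀ z, p - ((N + 1) * R : ℕ) ≤ z → z ≤ p + ((N + 1) * R : ℕ) → (z ∈ Λ₁ ↔ z ∈ Λ₁'))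
    (h₂ : ∀ z, q - ((N + 1) * R : ℕ) ≤ z → z ≤ q + ((N + 1) * R : ℕ) → (z ∈ Λ₂ ↔ z ∈ Λ₂'))
    {l : ℝ} (hl : 0 ≤ l) :
    ‖Φ.expansional p Λ₁ * Φ.expansional q Λ₂ - Φ.expansional p Λ₁' * Φ.expansional q Λ₂'‖ ≤
      2 * Real.exp (cutBound R J) * expansionalConst R J l * Real.exp (-(l * N)) := by
  have e : Φ.expansional p Λ₁ * Φ.expansional q Λ₂ - Φ.expansional p Λ₁' * Φ.expansional q Λ₂' =
      (Φ.expansional p Λ₁ - Φ.expansional p Λ₁') * Φ.expansional q Λ₂ +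
      Φ.expansional p Λ₁' * (Φ.expansional q Λ₂ - Φ.expansional q Λ₂') := by noncomm_ring
  have d1 := norm_expansional_sub_le hJ hR hr hs p N h₁ hl
  have d2 := norm_expansional_sub_le hJ hR hr hs q N h₂ hl
  have hc := expansionalConst_pos R hJ l
  have b1 := norm_expansional_le hJ hR hr hs q Λ₂
  have b2 := norm_expansional_le hJ hR hr hs p Λ₁'
  rw [e]
  calc _ ≤ ‖Φ.expansional p Λ₁ - Φ.expansional p Λ₁'‖ * ‖Φ.expansional q Λ₂‖ +
        ‖Φ.expansional p Λ₁'‖ * ‖Φ.expansional q Λ₂ - Φ.expansional q Λ₂'‖ :=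
        (norm_add_le _ _).trans (add_le_add (norm_mul_le _ _) (norm_mul_le _ _))
    _ ≤ (expansionalConst R J l * Real.exp (-(l * N))) * Real.exp (cutBound R J) +
        Real.exp (cutBound R J) * (expansionalConst R J l * Real.exp (-(l * N))) := by gcongr
    _ = _ := by ring

lemma norm_expansional₂_succ_sub_le (a e : ℤ) {l : ℝ} (hl : 0 ≤ l) (k : ℕ) :
    ‖Φ.expansional₂ a e (box R a e (k + 1)) - Φ.expansional₂ a e (box R a e k)‖ ≤
      2 * Real.exp (cutBound R J) * expansionalConst R J l * Real.exp (-(l * k)) := by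
  rw [expansional₂_eq, expansional₂_eq]
  refine norm_mul_expansional_sub_le hJ hR hr hs a e k (fun z h1 h2 => ?_) (fun z h1 h2 => ?_) hl
  · exact iff_of_true (mem_box_of_le (Nat.le_succ k) (by omega) h1 h2)
      (mem_box_of_le le_rfl (by omega) h1 h2)
  · rw [Finset.mem_filter, Finset.mem_filter]
    exact and_congr_left fun _ => iff_of_true (mem_box_of_le (Nat.le_succ k) (by omega) h1 h2)
      (mem_box_of_le le_rfl (by omega) h1 h2)

lemma exists_tendsto_expansional₂ (a e : ℤ) :
    ∃ E, Tendsto (fun k => Φ.expansional₂ a e (box R a e k)) atTop (𝓝 E) := by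
  refine cauchySeq_tendsto_of_complete (cauchySeq_of_summable_dist ?_)
  refine Summable.of_nonneg_of_le (fun _ => dist_nonneg) (fun k => ?_)
    (Real.summable_exp_neg_nat.mul_left (2 * Real.exp (cutBound R J) * expansionalConst R J 1))
  rw [dist_comm, dist_eq_norm]
  simpa using norm_expansional₂_succ_sub_le hJ hR hr hs a e zero_le_one k

/-- By `hN` the window around `e` stays to the right of `a`, so the restriction to sites `≥ a` is
invisible to the second factor. -/
lemma norm_mul_sub_le_of_tendsto {a e : ℤ} {E : QuasiLocalAlg d}
    (hE : Tendsto (fun k => Φ.expansional₂ a e (box R a e k)) atTop (𝓝 E)) (N : ℕ)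
    (hN : a ≤ e - ((N + 1) * R : ℕ)) :
    ‖E - Φ.expansional a (Finset.Icc (a - ((N + 1) * R : ℕ)) (a + ((N + 1) * R : ℕ))) *
      Φ.expansional e (Finset.Icc (e - ((N + 1) * R : ℕ)) (e + ((N + 1) * R : ℕ)))‖ ≤
      2 * Real.exp (cutBound R J) * expansionalConst R J 1 * Real.exp (-N) := by
  refine le_of_tendsto (hE.sub_const _).norm ?_
  filter_upwards [eventually_ge_atTop N] with k hk
  rw [expansional₂_eq]
  have := norm_mul_expansional_sub_le (Φ := Φ) hJ hR hr hs a e N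
    (Λ₁ := box R a e k) (Λ₂ := (box R a e k).filter (a ≤ ·))
    (Λ₁' := Finset.Icc (a - ((N + 1) * R : ℕ)) (a + ((N + 1) * R : ℕ)))
    (Λ₂' := Finset.Icc (e - ((N + 1) * R : ℕ)) (e + ((N + 1) * R : ℕ)))
    (fun z h1 h2 => iff_of_true (mem_box_of_le hk (by omega) h1 h2) (Finset.mem_Icc.2 ⟨h1, h2⟩))
    (fun z h1 h2 => iff_of_true (Finset.mem_filter.2
      ⟨mem_box_of_le hk (by omega) h1 h2, hN.trans h1⟩) (Finset.mem_Icc.2 ⟨h1, h2⟩))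
    (l := 1) zero_le_one
  simpa using this

lemma norm_le_of_tendsto_expansional₂ {a e : ℤ} {E : QuasiLocalAlg d}
    (hE : Tendsto (fun k => Φ.expansional₂ a e (box R a e k)) atTop (𝓝 E)) :
    ‖E‖ ≤ Real.exp (2 * cutBound R J) := by
  refine le_of_tendsto hE.norm (Eventually.of_forall fun k => ?_)
  rw [expansional₂_eq]
  exact norm_mul_expansional_le hJ hR hr hs _ _ _ _

lemma tendsto_conjExp_expansional₂ (a e : ℤ) {p : QuasiLocalAlg d}
    (hp : p ∈ Loc d (Finset.Ico a e)) (z : ℂ) (hz : ‖z‖ ≤ 1) :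
    Tendsto (fun k => conjExp z (Φ.qham (box R a e k)) (Φ.expansional₂ a e (box R a e k) * p) -
      Φ.complexEvolution z (Φ.expansional₂ a e (box R a e k) * p)) atTop (𝓝 0) := by
  have hG := siteStrength_pos R hJ
  refine tendsto_conjExp_sub_complexEvolution hJ hR hr hs
    (X := fun k => Φ.expansional₂ a e (box R a e k) * p)
    (C := 2 * Real.exp (cutBound R J) *
      expansionalConst R J (4 * siteStrength R J * R + 1) * ‖p‖) (fun k => ?_) (fun k => ?_) z hz
  · exact Subalgebra.mul_mem _ (expansional₂_mem a e _) (Loc_mono (Ico_subset_box R a e k) hp)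
  · rw [← sub_mul]
    refine (norm_mul_le _ _).trans ?_
    have := norm_expansional₂_succ_sub_le hJ hR hr hs a e
      (l := 4 * siteStrength R J * R + 1) (by positivity) k
    calc _ ≤ 2 * Real.exp (cutBound R J) * expansionalConst R J (4 * siteStrength R J * R + 1) *
          Real.exp (-((4 * siteStrength R J * R + 1) * k)) * ‖p‖ := by gcongr
      _ = _ := by ring

variable {ψ : QuasiLocalAlg d →L[ℂ] ℂ} (hψ : IsKMSState Φ ψ)
include hψ

/-- The bound of `norm_functional_ge` survives the limit: box evolution and infinite-volume
evolution of the expansionals differ by a null sequence, and `ψ` is invariant under the latter. -/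
lemma norm_apply_limit_ge {a e : ℤ} {E : QuasiLocalAlg d}
    (hE : Tendsto (fun k => Φ.expansional₂ a e (box R a e k)) atTop (𝓝 E)) :
    Real.exp (-(4 * cutBound R J)) ≤ ‖ψ E‖ := by
  have h1 := tendsto_conjExp_expansional₂ hJ hR hr hs a e
    (Subalgebra.one_mem (Loc d (Finset.Ico a e))) (-(1 / 2)) (by norm_num)
  simp only [mul_one] at h1
  have h2 : Tendsto (fun k => ψ (conjExp (-(1 / 2)) (Φ.qham (box R a e k))
      (Φ.expansional₂ a e (box R a e k)))) atTop (𝓝 (ψ E)) := by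
    have h3 := ((ψ.continuous.tendsto _).comp h1).add ((ψ.continuous.tendsto _).comp hE)
    rw [map_zero, zero_add] at h3
    refine h3.congr fun k => ?_
    have hm : Φ.expansional₂ a e (box R a e k) ∈ Loc d (box R a e k) := expansional₂_mem a e _
    simp only [Function.comp_apply, map_sub]
    rw [kms_invariant hJ hR hr hs hψ (by omega) hm]
    ring
  exact ge_of_tendsto h2.norm
    (Eventually.of_forall fun k => norm_functional_ge hJ hR hr hs hψ.isState a e _)

/-- KMS moves `E p` behind `q` as its evolution by `-1`; `expansional₂_conj` extracts the conjugated
`p` on the left of the evolved `E`; KMS read backwards, with `q p'` for `q`, restores `E` in front.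
-/
lemma kms_cut {a e : ℤ} {E : QuasiLocalAlg d}
    (hE : Tendsto (fun k => Φ.expansional₂ a e (box R a e k)) atTop (𝓝 E))
    {p q : QuasiLocalAlg d} (hp : p ∈ Loc d (Finset.Ico a e)) :
    ψ (E * p * q) = ψ (E * (q *
      (exp (-Φ.qham (Finset.Ico a e)) * p * exp (Φ.qham (Finset.Ico a e))))) := by
  set p' := exp (-Φ.qham (Finset.Ico a e)) * p * exp (Φ.qham (Finset.Ico a e)) with hp'
  have key : ∀ {u : QuasiLocalAlg d} (v : QuasiLocalAlg d), u ∈ Loc d (Finset.Ico a e) →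
      Tendsto (fun k => ψ (v * conjExp (-1) (Φ.qham (box R a e k))
        (Φ.expansional₂ a e (box R a e k) * u))) atTop (𝓝 (ψ (E * u * v))) := by
    intro u v hu
    have h1 := tendsto_conjExp_expansional₂ hJ hR hr hs a e hu (-1) (by norm_num)
    have h3 := ((ψ.continuous.tendsto _).comp (h1.const_mul v)).add
      ((ψ.continuous.tendsto _).comp ((hE.mul_const u).mul_const v))
    rw [mul_zero, map_zero, zero_add] at h3
    refine h3.congr fun k => ?_
    have hm : Φ.expansional₂ a e (box R a e k) * u ∈ Loc d (box R a e k) :=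
      Subalgebra.mul_mem _ (expansional₂_mem a e _) (Loc_mono (Ico_subset_box R a e k) hu)
    simp only [Function.comp_apply, mul_sub, map_sub]
    rw [kms_local hJ hR hr hs hψ (by omega) hm v]
    ring
  have k1 := key q hp
  have k2 := key (q * p') (Subalgebra.one_mem (Loc d (Finset.Ico a e)))
  simp only [mul_one] at k2
  have hcongr : ∀ k, ψ (q * conjExp (-1) (Φ.qham (box R a e k))
      (Φ.expansional₂ a e (box R a e k) * p)) = ψ (q * p' * conjExp (-1) (Φ.qham (box R a e k))
        (Φ.expansional₂ a e (box R a e k))) := by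
    intro k
    rw [expansional₂_conj R a e k hp, ← hp', mul_assoc q p']
  exact tendsto_nhds_unique (k1.congr hcongr) k2

/-- The Gibbs state of an interval in terms of the KMS state of the infinite chain. -/
lemma apply_mul_embed_eq {a e : ℤ} {E : QuasiLocalAlg d}
    (hE : Tendsto (fun k => Φ.expansional₂ a e (box R a e k)) atTop (𝓝 E))
    (M : RegionAlg d (Finset.Ico a e)) :
    ψ (E * embed d _ M) = ψ E * Φ.gibbs (Finset.Ico a e) M := by
  set I := Finset.Ico a e
  set h := Φ.hamiltonian I with hh
  have hinv : exp (-h) * exp h = 1 := exp_neg_mul_exp h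
  have hinv' : exp h * exp (-h) = 1 := exp_mul_exp_neg h
  have e1 : embed d I (exp (-h)) = exp (-Φ.qham I) := by
    rw [embed_exp, map_neg, hh, embed_hamiltonian]
  have e2 : embed d I (exp h) = exp (Φ.qham I) := by rw [embed_exp, hh, embed_hamiltonian]
  have hφ : ∀ P Q : RegionAlg d I,
      ψ (E * embed d I (P * Q)) = ψ (E * embed d I (Q * (exp (-h) * P * exp h))) := by
    intro P Q
    have := kms_cut hJ hR hr hs hψ hE (q := embed d I Q) (embed_mem_Loc P)
    rw [map_mul (embed d I), ← mul_assoc, this, map_mul (embed d I), map_mul (embed d I),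
      map_mul (embed d I), e1, e2]
  -- The weight `exp h` absorbs the conjugation in `hφ`, which makes the functional tracial.
  let f : RegionAlg d I →ₗ[ℂ] ℂ :=
    { toFun := fun M => ψ (E * embed d I (exp h * M))
      map_add' := fun M N => by rw [mul_add, map_add, mul_add, map_add]
      map_smul' := fun c M => by
        rw [mul_smul_comm, map_smul, mul_smul_comm, map_smul]; rfl }
  have hf : ∀ M N, f (M * N) = f (N * M) := by
    intro M N
    change ψ (E * embed d I (exp h * (M * N))) = ψ (E * embed d I (exp h * (N * M)))
    rw [← mul_assoc, hφ, hφ (exp h) (N * M)]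
    congr 3
    calc N * (exp (-h) * (exp h * M) * exp h) = N * (exp (-h) * exp h) * M * exp h := by
          simp only [mul_assoc]
      _ = N * M * ((exp (-h) * exp h) * exp h) := by rw [hinv]; simp only [mul_one, one_mul, mul_assoc]
  obtain ⟨c, hc⟩ := Matrix.linearMap_eq_smul_trace_of_mul_comm f hf
  have hM : ∀ M, ψ (E * embed d I M) = c * (exp (-h) * M).trace := by
    intro M
    rw [← hc]
    change _ = ψ (E * embed d I (exp h * (exp (-h) * M)))
    rw [← mul_assoc, hinv', one_mul]
  have h1 := hM 1
  rw [map_one, mul_one, mul_one] at h1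
  have hne : c * (exp (-h)).trace ≠ 0 := by
    rw [← h1]
    have := norm_apply_limit_ge hJ hR hr hs hψ hE
    exact norm_pos_iff.1 ((Real.exp_pos _).trans_le this)
  rw [hM, h1, gibbs, ← hh]
  have := right_ne_zero_of_mul hne
  field_simp

end bounds
end Interaction
end SpinChain

end

/-! ### Approximate factorization and the decay estimate. -/

noncomputable section

/-- The numbers `z₀, z₁, z₂, z₃` are close to `pq, xy, xq, py`, for which
`(xy)(pq) = (xq)(py)`. -/
lemma norm_mul_sub_mul_le {z₀ z₁ z₂ z₃ p q x y : ℂ} {ε V A C : ℝ} (hε : 0 ≤ ε) (hV : 0 ≤ V)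
    (hA : 0 ≤ A) (hC : 0 ≤ C)
    (h₀ : ‖z₀ - p * q‖ ≤ ε) (h₁ : ‖z₁ - x * y‖ ≤ ε * A * C) (h₂ : ‖z₂ - x * q‖ ≤ ε * A)
    (h₃ : ‖z₃ - p * y‖ ≤ ε * C) (n₀ : ‖z₀‖ ≤ V) (n₃ : ‖z₃‖ ≤ V * C)
    (hxy : ‖x * y‖ ≤ V * A * C) (hxq : ‖x * q‖ ≤ V * A) :
    ‖z₁ * z₀ - z₂ * z₃‖ ≤ 4 * V * ε * (A * C) := by
  have e : z₁ * z₀ - z₂ * z₃ = (z₁ - x * y) * z₀ + (x * y) * (z₀ - p * q) -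
      (z₂ - x * q) * z₃ - (x * q) * (z₃ - p * y) := by ring
  rw [e]
  calc _ ≤ ‖z₁ - x * y‖ * ‖z₀‖ + ‖x * y‖ * ‖z₀ - p * q‖ + ‖z₂ - x * q‖ * ‖z₃‖ +
        ‖x * q‖ * ‖z₃ - p * y‖ := by
        refine (norm_sub_le _ _).trans (add_le_add ((norm_sub_le _ _).trans
          (add_le_add ((norm_add_le _ _).trans (add_le_add ?_ ?_)) ?_)) ?_) <;> rw [norm_mul]
    _ ≤ (ε * A * C) * V + (V * A * C) * ε + (ε * A) * (V * C) + (V * A) * (ε * C) := by gcongr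
    _ = _ := by ring

namespace SpinChain
open NormedSpace BanachConj

lemma le_siteDist {a b c e : ℤ} (hab : a ≤ b) (hce : c ≤ e) :
    ((c - b : ℤ) : ℝ) ≤ siteDist (Finset.Icc a b) (Finset.Icc c e) := by
  have : Nonempty (↥(Finset.Icc a b) × ↥(Finset.Icc c e)) :=
    ⟨⟨⟨a, Finset.mem_Icc.2 ⟨le_rfl, hab⟩⟩, ⟨c, Finset.mem_Icc.2 ⟨le_rfl, hce⟩⟩⟩⟩
  refine le_ciInf fun p => ?_
  have h1 := Finset.mem_Icc.1 p.1.2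
  have h2 := Finset.mem_Icc.1 p.2.2
  rw [Int.dist_eq, abs_sub_comm]
  refine le_trans ?_ (le_abs_self _)
  exact_mod_cast (by omega : c - b ≤ (p.2 : ℤ) - (p.1 : ℤ))

lemma ExpDecay.norm_sub_le {d : ℕ} [NeZero d] {ψ : QuasiLocalAlg d →L[ℂ] ℂ} {K α : ℝ}
    (h : ExpDecay ψ K α) (hK : 0 ≤ K) (hα : 0 ≤ α) {a b c e : ℤ} (hab : a ≤ b) (hce : c ≤ e)
    {P Q : QuasiLocalAlg d} (hP : P ∈ Loc d (Finset.Icc a b)) (hQ : Q ∈ Loc d (Finset.Icc c e)) :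
    ‖ψ (P * Q) - ψ P * ψ Q‖ ≤ K * Real.exp (-(α * (c - b : ℤ))) * ‖P‖ * ‖Q‖ := by
  obtain ⟨M, rfl⟩ := mem_Loc.1 hP
  obtain ⟨N, rfl⟩ := mem_Loc.1 hQ
  refine (h a b c e hab hce M N).trans ?_
  rw [norm_embed, norm_embed]
  have := mul_le_mul_of_nonneg_left (le_siteDist hab hce) hα
  have h2 : -α * siteDist (Finset.Icc a b) (Finset.Icc c e) ≤ -(α * (c - b : ℤ)) := by linarith
  gcongr

namespace Interaction
variable {d : ℕ} [NeZero d] {Φ : Interaction d} {R : ℕ} {J : ℝ}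

section bounds
variable (hJ : 0 < J) (hR : 1 ≤ R) (hr : Φ.RangeLE R) (hs : Φ.HasStrength J)
include hJ hR hr hs

/-- The functional `ψ(E ·)` approximately factorizes over distant regions. -/
lemma norm_apply_mul_sub_le {ψ : QuasiLocalAlg d →L[ℂ] ℂ} (hψ : IsState ψ) {K α : ℝ}
    (hK : 0 ≤ K) (hα : 0 ≤ α) (hdec : ExpDecay ψ K α) {a b c e : ℤ} (hab : a ≤ b) (hce : c ≤ e)
    {E : QuasiLocalAlg d}
    (hE : Tendsto (fun k => Φ.expansional₂ a e (box R a e k)) atTop (𝓝 E)) {N m : ℕ}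
    (hm : m = (N + 1) * R) (hN : 2 * (m : ℤ) ≤ c - b) {P Q : QuasiLocalAlg d}
    (hP : P ∈ Loc d (Finset.Ico a b)) (hQ : Q ∈ Loc d (Finset.Ico c e)) :
    ‖ψ (E * (P * Q)) - ψ (Φ.expansional a (Finset.Icc (a - m) (a + m)) * P) *
      ψ (Φ.expansional e (Finset.Icc (e - m) (e + m)) * Q)‖ ≤
      (2 * Real.exp (cutBound R J) * expansionalConst R J 1 * Real.exp (-N) +
        K * Real.exp (2 * cutBound R J) * Real.exp (-(α * (c - b - 2 * m : ℤ)))) *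
        ‖P‖ * ‖Q‖ := by
  set S := Φ.expansional a (Finset.Icc (a - m) (a + m)) with hS
  set T := Φ.expansional e (Finset.Icc (e - m) (e + m)) with hT
  have hST : ‖E - S * T‖ ≤ 2 * Real.exp (cutBound R J) * expansionalConst R J 1 * Real.exp (-N) := by
    have := norm_mul_sub_le_of_tendsto hJ hR hr hs hE N (by rw [← hm]; omega)
    rwa [← hm] at this
  -- The window of `T` lies to the right of `b`, so `S T P Q` regroups as `(S P) (T Q)`, with a gap
  -- `c - b - 2 m` between the supports.
  have hcomm : T * P = P * T := by
    refine (commute_of_disjoint ?_ (expansional_mem e _) hP).eq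
    refine Finset.disjoint_left.2 fun z hz hz' => ?_
    have := Finset.mem_Icc.1 hz
    have := Finset.mem_Ico.1 hz'
    omega
  have hfac : S * T * (P * Q) = (S * P) * (T * Q) := by
    calc _ = S * (T * P) * Q := by simp only [mul_assoc]
      _ = _ := by rw [hcomm]; simp only [mul_assoc]
  have hSP : S * P ∈ Loc d (Finset.Icc (a - m) (b + m)) := by
    refine Subalgebra.mul_mem _ (Loc_mono ?_ (expansional_mem a _)) (Loc_mono ?_ hP)
    · exact Finset.Icc_subset_Icc le_rfl (by omega)
    · intro z hz
      rw [Finset.mem_Ico] at hz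
      rw [Finset.mem_Icc]
      omega
  have hTQ : T * Q ∈ Loc d (Finset.Icc (c - m) (e + m)) := by
    refine Subalgebra.mul_mem _ (Loc_mono ?_ (expansional_mem e _)) (Loc_mono ?_ hQ)
    · exact Finset.Icc_subset_Icc (by omega) le_rfl
    · intro z hz
      rw [Finset.mem_Ico] at hz
      rw [Finset.mem_Icc]
      omega
  have nS : ‖S * P‖ ≤ Real.exp (cutBound R J) * ‖P‖ := (norm_mul_le _ _).trans
    (mul_le_mul_of_nonneg_right (norm_expansional_le hJ hR hr hs _ _) (norm_nonneg _))
  have nT : ‖T * Q‖ ≤ Real.exp (cutBound R J) * ‖Q‖ := (norm_mul_le _ _).trans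
    (mul_le_mul_of_nonneg_right (norm_expansional_le hJ hR hr hs _ _) (norm_nonneg _))
  have h1 : ‖ψ (E * (P * Q)) - ψ (S * P * (T * Q))‖ ≤
      2 * Real.exp (cutBound R J) * expansionalConst R J 1 * Real.exp (-N) * (‖P‖ * ‖Q‖) := by
    rw [← map_sub, ← hfac, ← sub_mul]
    refine (hψ.norm_apply_le _).trans ((norm_mul_le _ _).trans ?_)
    exact mul_le_mul hST (norm_mul_le _ _) (norm_nonneg _) ((norm_nonneg _).trans hST)
  have h2 := hdec.norm_sub_le hK hα (by omega) (by omega) hSP hTQ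
  have e1 : c - (m : ℤ) - (b + m) = c - b - 2 * m := by ring
  rw [e1] at h2
  calc _ ≤ ‖ψ (E * (P * Q)) - ψ (S * P * (T * Q))‖ +
        ‖ψ (S * P * (T * Q)) - ψ (S * P) * ψ (T * Q)‖ := norm_sub_le_norm_sub_add_norm_sub _ _ _
    _ ≤ 2 * Real.exp (cutBound R J) * expansionalConst R J 1 * Real.exp (-N) * (‖P‖ * ‖Q‖) +
        K * Real.exp (-(α * (c - b - 2 * m : ℤ))) * (Real.exp (cutBound R J) * ‖P‖) *
          (Real.exp (cutBound R J) * ‖Q‖) := by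
        refine add_le_add h1 (h2.trans ?_)
        gcongr
    _ = _ := by rw [two_mul (cutBound R J), Real.exp_add]; ring

lemma norm_gibbs_sub_le {ψ : QuasiLocalAlg d →L[ℂ] ℂ} (hψ : IsKMSState Φ ψ) {K α : ℝ}
    (hK : 0 < K) (hα : 0 < α) (hdec : ExpDecay ψ K α) {a b c e : ℤ} (hab : a ≤ b) (hbc : b ≤ c)
    (hce : c ≤ e) (QA : RegionAlg d (Finset.Ico a b)) (QC : RegionAlg d (Finset.Ico c e)) :
    ‖Φ.gibbs (Finset.Ico a e)
          (extend d (Finset.Ico_subset_Ico_right (hbc.trans hce)) QA *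
            extend d (Finset.Ico_subset_Ico_left (hab.trans hbc)) QC) -
        Φ.gibbs (Finset.Ico a e) (extend d (Finset.Ico_subset_Ico_right (hbc.trans hce)) QA) *
        Φ.gibbs (Finset.Ico a e) (extend d (Finset.Ico_subset_Ico_left (hab.trans hbc)) QC)‖ ≤
      ‖QA‖ * ‖QC‖ * (4 * Real.exp (2 * cutBound R J) * Real.exp (8 * cutBound R J) *
        (2 * Real.exp (cutBound R J) * expansionalConst R J 1 * Real.exp 1 +
          K * Real.exp (2 * cutBound R J) * Real.exp (2 * R * α) +
          Real.exp (2 * cutBound R J) * Real.exp (4 * R * min (1 / (4 * (R : ℝ))) (α / 2)))) *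
        Real.exp (-(min (1 / (4 * (R : ℝ))) (α / 2) * (c - b : ℤ))) := by
  obtain ⟨E, hE⟩ := exists_tendsto_expansional₂ hJ hR hr hs a e
  have hgib := apply_mul_embed_eq hJ hR hr hs hψ hE
  have hEn := norm_le_of_tendsto_expansional₂ hJ hR hr hs hE
  have hlow := norm_apply_limit_ge hJ hR hr hs hψ hE
  set V := Real.exp (2 * cutBound R J) with hV
  have hV0 : 0 < V := Real.exp_pos _
  -- The rate `1 / (4 R)` comes from the locality error `exp (-N)` with `N ≈ n / (4 R)`; `α / 2` is
  -- left of `α` because the two windows use up half of the gap, up to a constant.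
  set α' := min (1 / (4 * (R : ℝ))) (α / 2) with hα'
  have hR0 : (0 : ℝ) < R := by exact_mod_cast hR
  have hα'0 : 0 < α' := lt_min (by positivity) (by positivity)
  have hX := expansionalConst_pos R hJ 1
  set X := 2 * Real.exp (cutBound R J) * expansionalConst R J 1 with hXdef
  have hX0 : 0 < X := by positivity
  set n : ℝ := ((c - b : ℤ) : ℝ) with hn
  have hn0 : 0 ≤ n := by rw [hn]; exact_mod_cast (by omega : 0 ≤ c - b)
  set ε := (X * Real.exp 1 + K * V * Real.exp (2 * R * α) + V * Real.exp (4 * R * α')) *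
    Real.exp (-(α' * n)) with hε
  have hε0 : 0 ≤ ε := by positivity
  set qA := embed d _ QA with hqA
  set qC := embed d _ QC with hqC
  have hA : qA ∈ Loc d (Finset.Ico a b) := embed_mem_Loc QA
  have hC : qC ∈ Loc d (Finset.Ico c e) := embed_mem_Loc QC
  have nA : ‖qA‖ = ‖QA‖ := norm_embed _ _
  have nC : ‖qC‖ = ‖QC‖ := norm_embed _ _
  have hval : ∀ u : QuasiLocalAlg d, ‖ψ (E * u)‖ ≤ V * ‖u‖ := fun u =>
    (hψ.isState.norm_apply_le _).trans ((norm_mul_le _ _).trans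
      (mul_le_mul_of_nonneg_right hEn (norm_nonneg _)))
  have n₀ : ‖ψ E‖ ≤ V := by simpa using hval 1
  have n₁ : ‖ψ (E * (qA * qC))‖ ≤ V * ‖QA‖ * ‖QC‖ := by
    rw [mul_assoc, ← nA, ← nC]
    exact (hval _).trans (mul_le_mul_of_nonneg_left (norm_mul_le _ _) hV0.le)
  have n₂ : ‖ψ (E * qA)‖ ≤ V * ‖QA‖ := nA ▸ hval qA
  have n₃ : ‖ψ (E * qC)‖ ≤ V * ‖QC‖ := nC ▸ hval qC
  have main : ‖ψ (E * (qA * qC)) * ψ E - ψ (E * qA) * ψ (E * qC)‖ ≤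
      4 * V * ε * (‖QA‖ * ‖QC‖) := by
    -- For gaps shorter than `4 R` the windows need not fit. The trivial bound suffices there, and
    -- the last summand of `ε` is chosen to give `V ≤ ε`.
    rcases lt_or_ge (c - b) (4 * R : ℕ) with hlt | hge
    · have hn4 : n ≤ 4 * R := by
        rw [hn]; exact_mod_cast hlt.le
      have hεV : V ≤ ε := by
        have h1 : 1 ≤ Real.exp (4 * R * α') * Real.exp (-(α' * n)) := by
          rw [← Real.exp_add]
          refine Real.one_le_exp ?_
          nlinarith
        calc V = V * 1 := (mul_one V).symm
          _ ≤ V * (Real.exp (4 * R * α') * Real.exp (-(α' * n))) := by gcongr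
          _ = (V * Real.exp (4 * R * α')) * Real.exp (-(α' * n)) := by ring
          _ ≤ ε := by
            rw [hε]
            refine mul_le_mul_of_nonneg_right ?_ (Real.exp_pos _).le
            have : 0 ≤ X * Real.exp 1 + K * V * Real.exp (2 * R * α) := by positivity
            linarith
      calc _ ≤ ‖ψ (E * (qA * qC))‖ * ‖ψ E‖ + ‖ψ (E * qA)‖ * ‖ψ (E * qC)‖ := by
            rw [← norm_mul, ← norm_mul]; exact norm_sub_le _ _
        _ ≤ (V * ‖QA‖ * ‖QC‖) * V + (V * ‖QA‖) * (V * ‖QC‖) := by gcongr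
        _ = 2 * V * V * (‖QA‖ * ‖QC‖) := by ring
        _ ≤ 4 * V * ε * (‖QA‖ * ‖QC‖) := by gcongr; norm_num
    · obtain ⟨k, hk⟩ := Int.eq_ofNat_of_zero_le (by omega : 0 ≤ c - b)
      -- Windows of about a quarter of the gap: `4 m ≤ k + 4 R ≤ 2 k`, so `2 m ≤ c - b`.
      set N := k / (4 * R) with hN
      set m := (N + 1) * R with hm
      have hk4 : 4 * R ≤ k := by
        rw [hk] at hge; exact_mod_cast hge
      have hNk : N * (4 * R) ≤ k := Nat.div_mul_le_self k (4 * R)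
      have hNk' : k < (N + 1) * (4 * R) := by
        have := Nat.lt_mul_div_succ k (by omega : 0 < 4 * R)
        rwa [mul_comm] at this
      have hm4 : 4 * m ≤ k + 4 * R := by
        have : 4 * m = N * (4 * R) + 4 * R := by rw [hm]; ring
        omega
      have hnk : n = k := by rw [hn, hk]; simp
      have key : 2 * (m : ℤ) ≤ c - b := by omega
      have hεle : X * Real.exp (-N) + K * V * Real.exp (-(α * (c - b - 2 * m : ℤ))) ≤ ε := by
        have h1 : Real.exp (-N) ≤ Real.exp 1 * Real.exp (-(α' * n)) := by
          rw [← Real.exp_add, Real.exp_le_exp]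
          have h2 : n ≤ (N + 1) * (4 * R) := by
            rw [hnk]; exact_mod_cast hNk'.le
          have h3 : α' * n ≤ N + 1 := by
            calc α' * n ≤ 1 / (4 * R) * ((N + 1) * (4 * R)) := by
                  gcongr; exact min_le_left _ _
              _ = N + 1 := by field_simp
          linarith
        have h2 : Real.exp (-(α * (c - b - 2 * m : ℤ))) ≤
            Real.exp (2 * R * α) * Real.exp (-(α' * n)) := by
          rw [← Real.exp_add, Real.exp_le_exp]
          have h3 : ((c - b - 2 * m : ℤ) : ℝ) = n - 2 * m := by
            rw [hn]; push_cast; ring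
          have h4 : (4 * m : ℝ) ≤ n + 4 * R := by rw [hnk]; exact_mod_cast hm4
          have h5 : n / 2 - 2 * R ≤ n - 2 * m := by linarith
          have h6 := mul_le_mul_of_nonneg_left h5 hα.le
          have h7 : α' * n ≤ α / 2 * n := by
            gcongr; exact min_le_right _ _
          rw [h3]
          linarith
        calc _ ≤ X * (Real.exp 1 * Real.exp (-(α' * n))) +
              K * V * (Real.exp (2 * R * α) * Real.exp (-(α' * n))) := by gcongr
          _ = (X * Real.exp 1 + K * V * Real.exp (2 * R * α)) * Real.exp (-(α' * n)) := by ring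
          _ ≤ ε := by
            rw [hε]
            refine mul_le_mul_of_nonneg_right ?_ (Real.exp_pos _).le
            have : 0 ≤ V * Real.exp (4 * R * α') := by positivity
            linarith
      have happ : ∀ {P Q : QuasiLocalAlg d}, P ∈ Loc d (Finset.Ico a b) →
          Q ∈ Loc d (Finset.Ico c e) → ‖ψ (E * (P * Q)) -
            ψ (Φ.expansional a (Finset.Icc (a - m) (a + m)) * P) *
              ψ (Φ.expansional e (Finset.Icc (e - m) (e + m)) * Q)‖ ≤ ε * ‖P‖ * ‖Q‖ := by
        intro P Q hP hQ
        refine (norm_apply_mul_sub_le hJ hR hr hs hψ.isState hK.le hα.le hdec hab hce hE hm key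
          hP hQ).trans ?_
        gcongr
      have hprod : ∀ P Q : QuasiLocalAlg d,
          ‖ψ (Φ.expansional a (Finset.Icc (a - m) (a + m)) * P) *
              ψ (Φ.expansional e (Finset.Icc (e - m) (e + m)) * Q)‖ ≤ V * ‖P‖ * ‖Q‖ := by
        intro P Q
        have hS := norm_expansional_le hJ hR hr hs a (Finset.Icc (a - (m : ℤ)) (a + m))
        have hT := norm_expansional_le hJ hR hr hs e (Finset.Icc (e - (m : ℤ)) (e + m))
        rw [norm_mul]
        calc _ ≤ (Real.exp (cutBound R J) * ‖P‖) * (Real.exp (cutBound R J) * ‖Q‖) := by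
              refine mul_le_mul ?_ ?_ (norm_nonneg _) (by positivity)
              · exact (hψ.isState.norm_apply_le _).trans ((norm_mul_le _ _).trans (by gcongr))
              · exact (hψ.isState.norm_apply_le _).trans ((norm_mul_le _ _).trans (by gcongr))
          _ = _ := by rw [hV, two_mul, Real.exp_add]; ring
      have one_mem : ∀ Λ : Finset ℤ, (1 : QuasiLocalAlg d) ∈ Loc d Λ :=
        fun Λ => Subalgebra.one_mem _
      -- With the same `S` and `T` in all four cases, `ψ S`, `ψ T`, `ψ (S qA)`, `ψ (T qC)` play the
      -- roles of `p`, `q`, `x`, `y` in `norm_mul_sub_mul_le`.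
      have k₀ := happ (one_mem _) (one_mem _)
      have k₁ := happ hA hC
      have k₂ := happ hA (one_mem _)
      have k₃ := happ (one_mem _) hC
      have p₁ := hprod qA qC
      have p₂ := hprod qA 1
      simp only [mul_one, one_mul, norm_one, nA, nC] at k₀ k₁ k₂ k₃ p₁ p₂
      exact norm_mul_sub_mul_le hε0 hV0.le (norm_nonneg _) (norm_nonneg _) k₀ k₁ k₂ k₃ n₀ n₃ p₁ p₂
  have eA := embed_extend (d := d) (Finset.Ico_subset_Ico_right (a := a) (hbc.trans hce)) QA
  have eC := embed_extend (d := d) (Finset.Ico_subset_Ico_left (b := e) (hab.trans hbc)) QC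
  have gA := hgib (extend d (Finset.Ico_subset_Ico_right (hbc.trans hce)) QA)
  have gC := hgib (extend d (Finset.Ico_subset_Ico_left (hab.trans hbc)) QC)
  have gAC := hgib (extend d (Finset.Ico_subset_Ico_right (hbc.trans hce)) QA *
    extend d (Finset.Ico_subset_Ico_left (hab.trans hbc)) QC)
  rw [map_mul (embed d _), eA, eC] at gAC
  rw [eA] at gA
  rw [eC] at gC
  rw [← hqA, ← hqC] at gAC
  rw [← hqA] at gA
  rw [← hqC] at gC
  rw [gAC, gA, gC] at main
  generalize Φ.gibbs (Finset.Ico a e) (extend d _ QA * extend d _ QC) = x₁ at *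
  generalize Φ.gibbs (Finset.Ico a e) (extend d _ QA) = x₂ at *
  generalize Φ.gibbs (Finset.Ico a e) (extend d _ QC) = x₃ at *
  -- The correlation appears with the factor `ψ(E)²`; dividing it out costs `exp (8 * cutBound R
  -- J)`.
  have e2 : ψ E * x₁ * ψ E - ψ E * x₂ * (ψ E * x₃) = ψ E ^ 2 * (x₁ - x₂ * x₃) := by ring
  rw [e2, norm_mul, norm_pow] at main
  have hlow2 : Real.exp (-(8 * cutBound R J)) ≤ ‖ψ E‖ ^ 2 := by
    calc _ = Real.exp (-(4 * cutBound R J)) ^ 2 := by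
          rw [← Real.exp_nat_mul]; congr 1; push_cast; ring
      _ ≤ _ := by gcongr
  have h8 : Real.exp (8 * cutBound R J) * Real.exp (-(8 * cutBound R J)) = 1 := by
    rw [← Real.exp_add]; simp
  calc ‖x₁ - x₂ * x₃‖ = Real.exp (8 * cutBound R J) *
        (Real.exp (-(8 * cutBound R J)) * ‖x₁ - x₂ * x₃‖) := by rw [← mul_assoc, h8, one_mul]
    _ ≤ Real.exp (8 * cutBound R J) * (‖ψ E‖ ^ 2 * ‖x₁ - x₂ * x₃‖) := by gcongr
    _ ≤ Real.exp (8 * cutBound R J) * (4 * V * ε * (‖QA‖ * ‖QC‖)) := by gcongr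
    _ = _ := by rw [hε]; ring

end bounds
end Interaction
end SpinChain

end

theorem theorem6p2 (r J K α : ℝ) (hr : 0 < r) (hJ : 0 < J) (hK : 0 < K) (hα : 0 < α) :
    ∃ K' α' : ℝ, 0 < K' ∧ 0 < α' ∧
      ∀ (d : ℕ) [NeZero d] (Φ : SpinChain.Interaction d), Φ.HasRange r → Φ.HasStrength J →
      ∀ ψ : SpinChain.QuasiLocalAlg d →L[ℂ] ℂ,
        SpinChain.IsKMSState Φ ψ → SpinChain.ExpDecay ψ K α →
      -- `A = [a, b)`, `B = [b, c)`, `C = [c, e)`, `I = ABC = [a, e)`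
      ∀ (a b c e : ℤ) (hab : a ≤ b) (hbc : b ≤ c) (hce : c ≤ e) (l : ℝ),
        0 ≤ l → l ≤ (Finset.Ico b c).card →
      ∀ (QA : SpinChain.RegionAlg d (Finset.Ico a b))
        (QC : SpinChain.RegionAlg d (Finset.Ico c e)),
        ‖Φ.gibbs (Finset.Ico a e)
              (SpinChain.extend d (Finset.Ico_subset_Ico_right (hbc.trans hce)) QA *
                SpinChain.extend d (Finset.Ico_subset_Ico_left (hab.trans hbc)) QC) -
            Φ.gibbs (Finset.Ico a e)
              (SpinChain.extend d (Finset.Ico_subset_Ico_right (hbc.trans hce)) QA) *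
            Φ.gibbs (Finset.Ico a e)
              (SpinChain.extend d (Finset.Ico_subset_Ico_left (hab.trans hbc)) QC)‖ ≤
          ‖QA‖ * ‖QC‖ * K' * Real.exp (-α' * l) := by
  -- Rounding up gives an integer range `R ≥ 1` depending on `r` alone, so the constants below
  -- involve only `r`, `J`, `K`, `α`.
  set R := ⌈r⌉₊ with hRdef
  have hR : 1 ≤ R := Nat.one_le_ceil_iff.2 hr
  have hR0 : (0 : ℝ) < R := by exact_mod_cast hR
  have hX := SpinChain.expansionalConst_pos R hJ 1
  refine ⟨4 * Real.exp (2 * SpinChain.cutBound R J) * Real.exp (8 * SpinChain.cutBound R J) *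
    (2 * Real.exp (SpinChain.cutBound R J) * SpinChain.expansionalConst R J 1 * Real.exp 1 +
      K * Real.exp (2 * SpinChain.cutBound R J) * Real.exp (2 * R * α) +
      Real.exp (2 * SpinChain.cutBound R J) *
        Real.exp (4 * R * min (1 / (4 * (R : ℝ))) (α / 2))),
    min (1 / (4 * (R : ℝ))) (α / 2), by positivity, lt_min (by positivity) (by positivity), ?_⟩
  intro d _ Φ hrange hstrength ψ hψ hdec a b c e hab hbc hce l hl hl' QA QC
  refine (Φ.norm_gibbs_sub_le hJ hR hrange.rangeLE hstrength hψ hK hα hdec hab hbc hce QA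
    QC).trans ?_
  refine mul_le_mul_of_nonneg_left (Real.exp_le_exp.2 ?_) (by positivity)
  have hlcb : l ≤ ((c - b : ℤ) : ℝ) := by
    refine hl'.trans (le_of_eq ?_)
    rw [Int.card_Ico, ← Int.cast_natCast, Int.toNat_of_nonneg (by omega)]
  have hα' : 0 ≤ min (1 / (4 * (R : ℝ))) (α / 2) := le_min (by positivity) (by positivity)
  have := mul_le_mul_of_nonneg_left hlcb hα'
  rw [neg_mul]
  linarith
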